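/- Let $s:\mathbb{Z}\to\mathbb{R}$ satisfy $s(0)=1$, and let $(X_{ij})_{i,j\ge 1}$ be a centered, jointly Gaussian family of real random variables with $$\mathbb{E}[X_{ij}X_{i'j'}]=\mathbf{1}_{\{i=i'\}}\,s(j-j')\qquad\text{for all } i,j,i',j'\ge 1.$$ For random $n\times n$ real matrices $\mathcal{A},\mathcal{B}$ put $$d_{\rm Wass}(\mathcal{A},\mathcal{B})=\sup\{\mathbb{E}[g(\mathcal{A})]-\mathbb{E}[g(\mathcal{B})]\},$$ where the supremum runs over all real functions $g$ on the $n\times n$ real matrices that are $1$-Lipschitz for the Hilbert–Schmidt norm. For $n,d\ge 1$ let $\mathcal{X}_{n,d}=(X_{ij})_{1\le i\le n,\,1\le j\le d}$ and $$\mathcal{W}_{n,d}=(W_{ij})_{1\le i,j\le n}=\sqrt d\left(\tfrac1d\,\mathcal{X}_{n,d}\mathcal{X}_{n,d}^T-\mathcal{I}_n\right),$$ and let $\mathcal{G}_{n,d}=(G_{ij})_{1\le i,j\le n}$ be a symmetric random matrix whose entries are centered and jointly Gaussian, with the same covariances as the entries of $\mathcal{W}_{n,d}$, that is, $\mathrm{Cov}(G_{ij},G_{kl})=\mathrm{Cov}(W_{ij},W_{kl})$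 for all $i,j,k,l$. Then, for all $n,d\ge 1$, $$d_{\rm Wass}(\mathcal{W}_{n,d},\mathcal{G}_{n,d})\le\sqrt{\frac{192\,n^3}{\sum_{|k|\le d}\left(1-\frac{|k|}{d}\right)s(k)^2}\times\frac1d\Big(\sum_{|k|\le d}|s(k)|^{4/3}\Big)^3}\le\sqrt{\frac{192\,n^3}{d}\Big(\sum_{|k|\le d}|s(k)|^{4/3}\Big)^3}.$$ Moreover, suppose that $s\in\ell^2(\mathbb{Z})$, write $\|s\|_2=\big(\sum_{k\in\mathbb{Z}}s(k)^2\big)^{1/2}$, and let $\mathcal{Z}_n=(Z_{ij})_{1\le i,j\le n}$ be a symmetric random matrix such that $\{Z_{ij}:1\le i\le j\le n\}$ are independent, $Z_{ii}\sim N(0,2\|s\|_2^2)$ and $Z_{ij}\sim N(0,\|s\|_2^2)$ for $i<j$. Then, for all $n,d\ge 1$, $$d_{\rm Wass}(\mathcal{G}_{n,d},\mathcal{Z}_n)\le\frac{2\sqrt{n(n+1)}}{\|s\|_2}\left(\sum_{|k|>d}s(k)^2+\frac1d\sum_{|k|\le d}|k|\,s(k)^2\right).$$ -/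

import Mathlib

open MeasureTheory ProbabilityTheory

open scoped ENNReal

/- Square matrices carry the Hilbert–Schmidt (Frobenius) norm `‖A‖ = √(∑ i j, (A i j) ^ 2)`. -/
attribute [local instance] Matrix.frobeniusNormedAddCommGroup

noncomputable section

namespace WishartGaussian

/-- The Wasserstein distance between two random `n × n` matrices `X` and `Y`, possibly defined on
different probability spaces:
`sup { E[g(X)] - E[g(Y)] : g is 1-Lipschitz for the Hilbert–Schmidt norm }`.
(The supremum is nonnegative because of `g = 0`, so nothing is lost by `ENNReal.ofReal`.) -/
def dWass {n : ℕ} {Ω Ω' : Type*} [MeasurableSpace Ω] [MeasurableSpace Ω']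
    (X : Ω → Matrix (Fin n) (Fin n) ℝ) (P : Measure Ω)
    (Y : Ω' → Matrix (Fin n) (Fin n) ℝ) (P' : Measure Ω') : ℝ≥0∞ :=
  ⨆ (g : Matrix (Fin n) (Fin n) ℝ → ℝ) (_ : LipschitzWith 1 g),
    ENNReal.ofReal ((∫ ω, g (X ω) ∂P) - ∫ ω, g (Y ω) ∂P')

/-- The double array `(X i j)` is a centered, jointly Gaussian family with
`E[X i j * X i' j'] = 1_{i = i'} s(j - j')`: its rows are independent copies of a stationary
centered Gaussian sequence with correlation function `s`. -/
structure IsRowIndepGaussianArray {Ω : Type*} [MeasurableSpace Ω]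
    (s : ℤ → ℝ) (X : ℕ → ℕ → Ω → ℝ) (P : Measure Ω) : Prop where
  gaussian : IsGaussianProcess (fun p : ℕ × ℕ => X p.1 p.2) P
  centered : ∀ i j, ∫ ω, X i j ω ∂P = 0
  covariance : ∀ i j i' j', ∫ ω, X i j ω * X i' j' ω ∂P =
    if i = i' then s ((j : ℤ) - (j' : ℤ)) else 0

/-- The `n × d` random matrix with entries `X i j`. -/
def dataMatrix {Ω : Type*} (X : ℕ → ℕ → Ω → ℝ) (n d : ℕ) (ω : Ω) :
    Matrix (Fin n) (Fin d) ℝ :=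
  Matrix.of fun i j => X i j ω

/-- The normalized Wishart matrix `√d (d⁻¹ 𝒳 𝒳ᵀ - I)`. -/
def wishart {Ω : Type*} (X : ℕ → ℕ → Ω → ℝ) (n d : ℕ) (ω : Ω) :
    Matrix (Fin n) (Fin n) ℝ :=
  √(d : ℝ) • ((d : ℝ)⁻¹ • (dataMatrix X n d ω * (dataMatrix X n d ω).transpose) - 1)

/-- `G` is a symmetric random matrix whose entries are centered and jointly Gaussian, with the same
covariances as the entries of the random matrix `W`. -/
structure IsGaussianCounterpart {n : ℕ} {Ω Ω' : Type*} [MeasurableSpace Ω] [MeasurableSpace Ω']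
    (W : Ω → Matrix (Fin n) (Fin n) ℝ) (P : Measure Ω)
    (G : Ω' → Matrix (Fin n) (Fin n) ℝ) (P' : Measure Ω') : Prop where
  symm : ∀ᵐ ω ∂P', (G ω).IsSymm
  gaussian : HasGaussianLaw (fun ω (p : Fin n × Fin n) => G ω p.1 p.2) P'
  centered : ∀ i j, ∫ ω, G ω i j ∂P' = 0
  covariance : ∀ i j k l,
    cov[fun ω => G ω i j, fun ω => G ω k l; P'] = cov[fun ω => W ω i j, fun ω => W ω k l; P]

/-- `Z` is a symmetric random matrix with independent entries on and above the diagonal,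
`Z i i ∼ N(0, 2v)` and `Z i j ∼ N(0, v)` for `i < j`. -/
structure IsGOE {n : ℕ} {Ω : Type*} [MeasurableSpace Ω] (v : ℝ)
    (Z : Ω → Matrix (Fin n) (Fin n) ℝ) (P : Measure Ω) : Prop where
  symm : ∀ᵐ ω ∂P, (Z ω).IsSymm
  diag : ∀ i, HasLaw (fun ω => Z ω i i) (gaussianReal 0 (2 * v).toNNReal) P
  offDiag : ∀ i j, i < j → HasLaw (fun ω => Z ω i j) (gaussianReal 0 v.toNNReal) P
  indep : iIndepFun
    (fun (p : {p : Fin n × Fin n // p.1 ≤ p.2}) ω => Z ω p.1.1 p.1.2) P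

/-- The norm of `s` in `ℓ²(ℤ)` (for square-summable `s`). -/
def l2Norm (s : ℤ → ℝ) : ℝ := √(∑' k : ℤ, s k ^ 2)

end WishartGaussian

end

/-! First bound. Write `W` for the Wishart matrix, a quadratic function of the Gaussian vector `X`,
and take its Gaussian counterpart `G` independent of `X`. For a smooth test function `h`,
interpolate along `sin θ • W + cos θ • G`. The derivative in `θ` of the expectation of `h` is `cos θ
E⟨W, ∇h⟩ - sin θ E⟨G, ∇h⟩`. Gaussian integration by parts turns both terms into expectations of
second derivatives of `h`: with `S = (s (k - r))`, `M = d⁻¹ X S Xᵀ` and `v = avgSq d s`, so that `E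
M = v I`, their difference is `sin θ cos θ` times a pairing of `M - v I` with the Hessian of `h`.

The Hessian of a Lipschitz function is not under control, so one derivative is moved back:
conditionally on `X`, integration by parts in `G`, read from right to left, replaces the Hessian by
`∇h` and a factor `G / (v cos θ)`. The factor `cos θ` cancels, and what remains is `(sin θ / v) E⟨G
(M - v I)ᵀ, ∇h⟩` (`sum_integral_eq_sum_integral_stein`). As `∇h` has Euclidean norm at most 1, this
is at most `v⁻¹ (E‖G (M - v I)ᵀ‖²)^(1/2)`, and integrating over `[0, π/2]` costs a factor `π/2`.
Only the Lipschitz constant of `h` enters, so the estimate passes to any Lipschitz `g` by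
mollification.

The second moment equals `v (n + 1)` times the total variance of the entries of `M`
(`integral_sum_stein_sq`). By Isserlis' formula this variance is at most `n (n + 1) d⁻²` times
`‖|S|²‖²`, with `|S|` the entrywise absolute value, and a Young-type inequality `ℓ^(4/3) * ℓ^(4/3) →
ℓ²` bounds the latter by `d (∑ |s k|^(4/3))³` (`sum_sq_sum_toeplitz_le`).

Second bound. The entries of `W` have exactly the covariance of a symmetric matrix with independent
upper triangle and off-diagonal variance `avgSq d s` (`covariance_wishartMap`). Hence `G` has the
law of `Z` multiplied by a scalar, and scaling is an explicit coupling. -/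

/-! ### Smoothing of Lipschitz functions -/

/-- Convolution with a bump `f` of integral 1 supported in a ball of radius `ε` averages translates
of `g`, so it keeps the Lipschitz constant and moves values by at most `ε`. Its derivative is `g *
Df`, which is Lipschitz with constant `∫ ‖Df‖`; this bounds the second derivative. That bound
degenerates as `ε → 0`, but it serves only for integrability. -/
theorem LipschitzWith.exists_contDiff_two_approx {E : Type*} [NormedAddCommGroup E]
    [NormedSpace ℝ E] [FiniteDimensional ℝ E] {g : E → ℝ} (hg : LipschitzWith 1 g) {ε : ℝ}
    (hε : 0 < ε) :
    ∃ h : E → ℝ, ContDiff ℝ 2 h ∧ LipschitzWith 1 h ∧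
      (∃ K, ∀ x, ‖fderiv ℝ (fderiv ℝ h) x‖ ≤ K) ∧ ∀ x, |h x - g x| ≤ ε := by
  borelize E
  let μ : Measure E := MeasureTheory.Measure.addHaar
  let φ : ContDiffBump (0 : E) := ⟨ε / 2, ε, by linarith, by linarith⟩
  let f := φ.normed μ
  have hgc := hg.continuous
  have hfc : HasCompactSupport f := φ.hasCompactSupport_normed
  have hfs : ContDiff ℝ 2 f := φ.contDiff_normed
  have hint : ∀ x, Integrable (fun t => f t * g (x - t)) μ := fun x =>
    (hfs.continuous.mul (by fun_prop)).integrable_of_hasCompactSupport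
      (hfc.mul_right)
  have hint' : ∀ x, Integrable (fun t => g (x - t) • fderiv ℝ f t) μ := fun x =>
    ((by fun_prop : Continuous fun t => g (x - t)).smul
      (hfs.continuous_fderiv (by norm_num))).integrable_of_hasCompactSupport
      ((hfc.fderiv ℝ).smul_left)
  have hnd : Integrable (fun t => ‖fderiv ℝ f t‖) μ :=
    ((hfs.continuous_fderiv (by norm_num)).integrable_of_hasCompactSupport (hfc.fderiv ℝ)).norm
  have hgd : ∀ x y, |g x - g y| ≤ ‖x - y‖ := fun x y => by
    simpa [Real.dist_eq, dist_eq_norm] using hg.dist_le_mul x y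
  have hf1 : ∫ t, f t ∂μ = 1 := φ.integral_normed
  have hfi : Integrable f μ := hfs.continuous.integrable_of_hasCompactSupport hfc
  have hf0 : ∀ t, 0 ≤ f t := φ.nonneg_normed
  let h : E → ℝ := fun x => ∫ t, f t * g (x - t) ∂μ
  have hconv : h = MeasureTheory.convolution f g (ContinuousLinearMap.lsmul ℝ ℝ) μ := by
    ext x; simp [h, MeasureTheory.convolution]
  have hd : ∀ x, fderiv ℝ h x = ∫ t, g (x - t) • fderiv ℝ f t ∂μ := by
    intro x
    rw [hconv, (hfc.hasFDerivAt_convolution_left (ContinuousLinearMap.lsmul ℝ ℝ)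
      (hfs.of_le (by norm_num)) hgc.locallyIntegrable x).fderiv]
    unfold MeasureTheory.convolution
    congr 1
    ext t v
    simp [ContinuousLinearMap.precompL, mul_comm]
  refine ⟨h, ?_, ?_, ⟨∫ t, ‖fderiv ℝ f t‖ ∂μ, ?_⟩, ?_⟩
  · rw [hconv]
    exact_mod_cast hfc.contDiff_convolution_left (n := 2) _ hfs hgc.locallyIntegrable
  · refine LipschitzWith.of_dist_le_mul fun x y => ?_
    rw [Real.dist_eq, ← integral_sub (hint x) (hint y), dist_eq_norm, NNReal.coe_one, one_mul]
    calc |∫ t, f t * g (x - t) - f t * g (y - t) ∂μ|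
        ≤ ∫ t, f t * ‖x - y‖ ∂μ := by
          rw [← Real.norm_eq_abs]
          refine norm_integral_le_of_norm_le (hfi.mul_const _) (.of_forall fun t => ?_)
          rw [← mul_sub, norm_mul, Real.norm_of_nonneg (hf0 t)]
          refine mul_le_mul_of_nonneg_left ?_ (hf0 t)
          simpa using hgd (x - t) (y - t)
      _ = ‖x - y‖ := by rw [integral_mul_const, hf1, one_mul]
  · have hL : LipschitzWith (∫ t, ‖fderiv ℝ f t‖ ∂μ).toNNReal (fderiv ℝ h) := by
      refine LipschitzWith.of_dist_le_mul fun x y => ?_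
      rw [dist_eq_norm, hd, hd, ← integral_sub (hint' x) (hint' y), dist_eq_norm,
        Real.coe_toNNReal _ (by positivity), ← integral_mul_const]
      refine norm_integral_le_of_norm_le (hnd.mul_const _) (.of_forall fun t => ?_)
      rw [← sub_smul, norm_smul, mul_comm]
      refine mul_le_mul_of_nonneg_left ?_ (norm_nonneg _)
      simpa using hgd (x - t) (y - t)
    intro x
    have := norm_fderiv_le_of_lipschitz ℝ hL (x₀ := x)
    rwa [Real.coe_toNNReal _ (by positivity)] at this
  · intro x
    have : h x - g x = ∫ t, f t * (g (x - t) - g x) ∂μ := by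
      simp only [mul_sub]
      rw [integral_sub (hint x) (hfi.mul_const _), integral_mul_const, hf1, one_mul]
    rw [this, ← Real.norm_eq_abs]
    calc ‖∫ t, f t * (g (x - t) - g x) ∂μ‖ ≤ ∫ t, f t * ε ∂μ := by
          refine norm_integral_le_of_norm_le (hfi.mul_const _) (.of_forall fun t => ?_)
          rw [norm_mul, Real.norm_of_nonneg (hf0 t)]
          by_cases ht : f t = 0
          · simp [ht]
          refine mul_le_mul_of_nonneg_left ?_ (hf0 t)
          have h1 : t ∈ Function.support f := ht
          rw [φ.support_normed_eq] at h1
          have h2 := hgd (x - t) x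
          simp at h1 h2
          exact h2.trans h1.le
      _ = ε := by rw [integral_mul_const, hf1, one_mul]

/-! ### Gaussian integration by parts -/

/-- Stein's identity: the Gaussian density `p` satisfies `p' = -(t / v) p`, so this is integration
by parts on the line. -/
theorem integral_id_mul_gaussianReal {v : NNReal} (hv : v ≠ 0) {f f' : ℝ → ℝ}
    (hd : ∀ t, HasDerivAt f (f' t) t) (hf : Integrable f (gaussianReal 0 v))
    (hf' : Integrable f' (gaussianReal 0 v))
    (htf : Integrable (fun t => t * f t) (gaussianReal 0 v)) :
    ∫ t, t * f t ∂gaussianReal 0 v = v * ∫ t, f' t ∂gaussianReal 0 v := by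
  have hv' : (v : ℝ) ≠ 0 := by exact_mod_cast hv
  have hp : ∀ t, HasDerivAt (gaussianPDFReal 0 v) (-(t / v) * gaussianPDFReal 0 v t) t := by
    intro t
    have h1 : HasDerivAt (fun x : ℝ => -(x - 0) ^ 2 / (2 * v)) (-(t / v)) t := by
      have := (((hasDerivAt_id t).sub_const 0).pow 2).neg.div_const (2 * (v : ℝ))
      refine this.congr_deriv ?_
      simp
      field_simp
    have h2 := h1.exp.const_mul ((√(2 * Real.pi * v))⁻¹)
    unfold gaussianPDFReal
    exact h2.congr_deriv (by ring)
  have key : ∀ {F : ℝ → ℝ}, Integrable F (gaussianReal 0 v) →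
      Integrable (fun t => gaussianPDFReal 0 v t * F t) := by
    intro F hF
    rw [gaussianReal_of_var_ne_zero _ hv, gaussianPDF_def,
      integrable_withDensity_iff_integrable_smul' (by fun_prop) (by simp)] at hF
    simpa [ENNReal.toReal_ofReal, gaussianPDFReal_nonneg] using hF
  rw [integral_gaussianReal_eq_integral_smul hv, integral_gaussianReal_eq_integral_smul hv]
  have h1 := integral_mul_deriv_eq_deriv_mul_of_integrable (u := gaussianPDFReal 0 v) (v := f)
    (u' := fun t => -(t / v) * gaussianPDFReal 0 v t) (v' := f') (fun x _ => hp x) (fun x _ => hd x)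
    (key hf') (by
      refine ((key htf).const_mul (-(1 / (v : ℝ)))).congr (.of_forall fun t => ?_)
      simp only [Pi.mul_apply]; ring) (key hf)
  simp only [smul_eq_mul]
  rw [h1, ← integral_neg, ← integral_const_mul]
  congr 1
  ext t
  field_simp

/-- Continuous functions of at most polynomial growth. -/
def PolyGrowth {V : Type*} [NormedAddCommGroup V] (f : V → ℝ) : Prop :=
  Continuous f ∧ ∃ (C : ℝ) (k : ℕ), ∀ z, |f z| ≤ C * (1 + ‖z‖) ^ k

namespace PolyGrowth

variable {V : Type*} [NormedAddCommGroup V] {f g : V → ℝ}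

theorem of_bounded (hf : Continuous f) {C : ℝ} (h : ∀ z, |f z| ≤ C) : PolyGrowth f :=
  ⟨hf, C, 0, by simpa using h⟩

theorem const (c : ℝ) : PolyGrowth (fun _ : V => c) :=
  of_bounded continuous_const (fun _ => le_rfl)

theorem clm [NormedSpace ℝ V] (L : V →L[ℝ] ℝ) : PolyGrowth L := by
  refine ⟨L.continuous, ‖L‖, 1, fun z => ?_⟩
  refine (L.le_opNorm z).trans ?_
  rw [pow_one]
  gcongr
  linarith

theorem mul (hf : PolyGrowth f) (hg : PolyGrowth g) : PolyGrowth (fun z => f z * g z) := by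
  obtain ⟨hf, C, k, h⟩ := hf
  obtain ⟨hg, C', k', h'⟩ := hg
  refine ⟨hf.mul hg, C * C', k + k', fun z => ?_⟩
  rw [abs_mul, pow_add, mul_mul_mul_comm]
  exact mul_le_mul (h z) (h' z) (abs_nonneg _) ((abs_nonneg _).trans (h z))

theorem add (hf : PolyGrowth f) (hg : PolyGrowth g) : PolyGrowth (fun z => f z + g z) := by
  obtain ⟨hf, C, k, h⟩ := hf
  obtain ⟨hg, C', k', h'⟩ := hg
  refine ⟨hf.add hg, |C| + |C'|, k + k', fun z => ?_⟩
  have h1 : (1 : ℝ) ≤ 1 + ‖z‖ := by linarith [norm_nonneg z]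
  calc |f z + g z| ≤ |f z| + |g z| := abs_add_le _ _
    _ ≤ C * (1 + ‖z‖) ^ k + C' * (1 + ‖z‖) ^ k' := add_le_add (h z) (h' z)
    _ ≤ |C| * (1 + ‖z‖) ^ (k + k') + |C'| * (1 + ‖z‖) ^ (k + k') := by
        gcongr
        exacts [le_abs_self C, Nat.le_add_right _ _, le_abs_self C', Nat.le_add_left _ _]
    _ = _ := by ring

theorem const_mul (c : ℝ) (hf : PolyGrowth f) : PolyGrowth (fun z => c * f z) := (const c).mul hf

theorem neg (hf : PolyGrowth f) : PolyGrowth (fun z => -f z) := by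
  simpa using hf.const_mul (-1)

theorem sub (hf : PolyGrowth f) (hg : PolyGrowth g) : PolyGrowth (fun z => f z - g z) := by
  simpa [sub_eq_add_neg] using hf.add hg.neg

theorem sum {ι : Type*} (s : Finset ι) {F : ι → V → ℝ} (h : ∀ i ∈ s, PolyGrowth (F i)) :
    PolyGrowth (fun z => ∑ i ∈ s, F i z) := by
  classical
  induction s using Finset.induction_on with
  | empty => simpa using const 0
  | insert a s ha ih =>
    simp only [Finset.sum_insert ha]
    exact (h a (by simp)).add (ih fun i hi => h i (by simp [hi]))

theorem comp_of_norm_le {W : Type*} [NormedAddCommGroup W] {p : W → V} (hf : PolyGrowth f)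
    (hp : Continuous p) (hle : ∀ w, ‖p w‖ ≤ ‖w‖) : PolyGrowth (fun w => f (p w)) := by
  obtain ⟨hf, C, k, h⟩ := hf
  refine ⟨hf.comp hp, |C|, k, fun w => (h _).trans ?_⟩
  gcongr
  · exact le_abs_self C
  · exact hle w

theorem comp_fst {W : Type*} [NormedAddCommGroup W] (hf : PolyGrowth f) :
    PolyGrowth (fun z : V × W => f z.1) :=
  hf.comp_of_norm_le continuous_fst norm_fst_le

theorem comp_snd {W : Type*} [NormedAddCommGroup W] (hf : PolyGrowth f) :
    PolyGrowth (fun z : W × V => f z.2) :=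
  hf.comp_of_norm_le continuous_snd norm_snd_le

/-- Gaussian measures have moments of all orders. With the closure properties above, this settles
most integrability questions below. -/
theorem integrable [NormedSpace ℝ V] [CompleteSpace V] [SecondCountableTopology V]
    [MeasurableSpace V] [BorelSpace V] (μ : Measure V) [IsGaussian μ]
    (hf : PolyGrowth f) : Integrable f μ := by
  obtain ⟨hf, C, k, h⟩ := hf
  have h0 : MemLp (fun z : V => ‖z‖) (k : ℝ≥0∞) μ :=
    (IsGaussian.memLp_id μ (k : ℝ≥0∞) (by simp)).norm
  have hc : MemLp (fun _ : V => (1 : ℝ)) (k : ℝ≥0∞) μ := memLp_const 1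
  have h1 : MemLp (fun z : V => 1 + ‖z‖) (k : ℝ≥0∞) μ := hc.add h0
  have h2 : Integrable (fun z : V => C * (1 + ‖z‖) ^ k) μ := by
    refine Integrable.const_mul ?_ C
    refine h1.integrable_norm_pow'.congr (.of_forall fun z => ?_)
    simp only
    rw [Real.norm_of_nonneg (by positivity)]
  exact h2.mono' hf.aestronglyMeasurable (.of_forall h)

end PolyGrowth

/-- The vector `c` represents the covariance with `l`. Subtracting from `z` its regression on `l z`,
along `c`, leaves a part independent of `l`; conditionally on that part, the claim is the
one-dimensional Stein identity on a line in direction `c`. -/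
theorem ProbabilityTheory.IsGaussian.integral_dual_mul_eq_integral_deriv {V : Type*}
    [NormedAddCommGroup V] [NormedSpace ℝ V] [CompleteSpace V] [SecondCountableTopology V]
    [MeasurableSpace V] [BorelSpace V] (μ : Measure V) [IsGaussian μ] (l : StrongDual ℝ V) (c : V)
    (hl : μ[l] = 0) (hc : ∀ L : StrongDual ℝ V, cov[l, L; μ] = L c) {φ φ' : V → ℝ}
    (hφ : PolyGrowth φ) (hφ' : PolyGrowth φ')
    (hd : ∀ z, HasDerivAt (fun t : ℝ => φ (z + t • c)) (φ' z) 0) :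
    ∫ z, l z * φ z ∂μ = ∫ z, φ' z ∂μ := by
  have hvar : Var[l; μ] = l c := by rw [← hc l, covariance_self (by fun_prop)]
  have hlc : 0 ≤ l c := hvar ▸ variance_nonneg _ _
  have hd' : ∀ z t, HasDerivAt (fun t : ℝ => φ (z + t • c)) (φ' (z + t • c)) t := by
    intro z t
    have h1 := hd (z + t • c)
    rw [← sub_self t] at h1
    have h2 := h1.comp_sub_const t t
    refine (h2.congr_of_eventuallyEq (.of_forall fun u => ?_))
    simp only [sub_smul]
    congr 1
    abel
  -- Since `l c` is the variance of `l`, vanishing makes `l = 0` almost everywhere, hence `c = 0`,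
  -- and both sides are zero.
  rcases hlc.eq_or_lt with h0 | hpos
  · have hl0 : ∀ᵐ z ∂μ, l z = 0 := by
      have := ae_eq_integral_of_variance_eq_zero (IsGaussian.memLp_dual μ l 2 (by simp))
        (hvar.trans h0.symm)
      simpa [hl] using this
    have hc0 : c = 0 := by
      refine SeparatingDual.eq_zero_of_forall_dual_eq_zero (R := ℝ) fun L => ?_
      rw [← hc L, covariance, hl, integral_eq_zero_of_ae]
      filter_upwards [hl0] with z hz
      simp [hz]
    have hφ0 : ∀ z, φ' z = 0 := fun z => by
      have := hd z
      simp only [hc0, smul_zero, add_zero] at this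
      exact this.unique (hasDerivAt_const _ _)
    simp only [hφ0, integral_zero]
    rw [integral_eq_zero_of_ae]
    filter_upwards [hl0] with z hz
    simp [hz]
  · set v : NNReal := (l c).toNNReal with hv
    have hvc : (v : ℝ) = l c := Real.coe_toNNReal _ hlc
    have hv0 : v ≠ 0 := by simpa [hv] using hpos
    -- The regression residual: `cov[l, L ∘ Y] = L (Y c) = 0` because `Y c = 0`, and uncorrelated
    -- jointly Gaussian variables are independent.
    let Y : V →L[ℝ] V := ContinuousLinearMap.id ℝ V - (l.smulRight ((1 / l c) • c))
    have hYz : ∀ z, Y z = z - (l z / l c) • c := fun z => by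
      simp [Y, smul_smul, div_eq_mul_inv]
    have hG : HasGaussianLaw (fun z => (Y z, l z)) μ :=
      (IsGaussian.hasGaussianLaw_id (μ := μ)).map (Y.prod l)
    have hind : IndepFun Y l μ := by
      refine hG.indepFun_of_covariance_strongDual fun L₁ L₂ => ?_
      have e1 : (L₁ ∘ Y : V → ℝ) = (L₁.comp Y : StrongDual ℝ V) := rfl
      have e2 : (L₂ ∘ l : V → ℝ) = fun z => L₂ 1 * l z := by
        ext z
        have : L₂ (l z) = L₂ (l z • (1 : ℝ)) := by simp
        simp only [Function.comp_apply]
        rw [this, map_smul, smul_eq_mul, mul_comm]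
      rw [e2, covariance_const_mul_right, covariance_comm, e1, hc]
      simp [hYz, hpos.ne']
    have hlaw : μ.map l = gaussianReal 0 v := by
      rw [IsGaussian.map_eq_gaussianReal l, hl, hvar]
    have hprod : μ.map (fun z => (Y z, l z)) = (μ.map Y).prod (gaussianReal 0 v) := by
      rw [← hlaw]
      exact (indepFun_iff_map_prod_eq_prod_map_map (by fun_prop) (by fun_prop)).1 hind
    have hrec : ∀ z, Y z + (l z / l c) • c = z := fun z => by rw [hYz]; abel
    have htr : ∀ {F : V → ℝ}, Continuous F → ∀ (q : ℝ → ℝ), Continuous q →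
        Integrable (fun z => q (l z) * F z) μ →
        Integrable (fun p : V × ℝ => q p.2 * F (p.1 + (p.2 / l c) • c))
          ((μ.map Y).prod (gaussianReal 0 v)) ∧
        ∫ z, q (l z) * F z ∂μ =
          ∫ y, ∫ t, q t * F (y + (t / l c) • c) ∂gaussianReal 0 v ∂(μ.map Y) := by
      intro F hF q hq hi
      have hcont : Continuous (fun p : V × ℝ => q p.2 * F (p.1 + (p.2 / l c) • c)) := by fun_prop
      have h1 : Integrable (fun p : V × ℝ => q p.2 * F (p.1 + (p.2 / l c) • c))
          ((μ.map Y).prod (gaussianReal 0 v)) := by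
        rw [← hprod, integrable_map_measure hcont.aestronglyMeasurable (by fun_prop)]
        refine hi.congr (.of_forall fun z => ?_)
        simp [hrec]
      refine ⟨h1, ?_⟩
      rw [← integral_prod _ h1, ← hprod,
        integral_map (by fun_prop) hcont.aestronglyMeasurable]
      simp [hrec]
    obtain ⟨i1, e1⟩ := htr hφ.1 (fun t => t) continuous_id (((PolyGrowth.clm l).mul hφ).integrable μ)
    obtain ⟨i2, e2⟩ := htr hφ.1 (fun _ => 1) continuous_const
      (((PolyGrowth.const 1).mul hφ).integrable μ)
    obtain ⟨i3, e3⟩ := htr hφ'.1 (fun _ => 1) continuous_const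
      (((PolyGrowth.const 1).mul hφ').integrable μ)
    have e3' : ∫ z, φ' z ∂μ = ∫ z, 1 * φ' z ∂μ := by simp
    rw [e3', e3, e1]
    refine integral_congr_ae ?_
    filter_upwards [i1.prod_right_ae, i2.prod_right_ae, i3.prod_right_ae] with y h1 h2 h3
    simp only [one_mul] at h1 h2 h3 ⊢
    rw [integral_id_mul_gaussianReal hv0 (f' := fun t => φ' (y + (t / l c) • c) * (1 / l c))
      _ h2 (h3.mul_const _) h1, integral_mul_const, hvc]
    · field_simp
    · intro t
      exact HasDerivAt.comp t (hd' y (t / l c)) ((hasDerivAt_id t).div_const (l c))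

/-! ### Integration by parts in one of two independent Gaussian vectors -/

section Product

variable {V W : Type*} [NormedAddCommGroup V] [NormedSpace ℝ V]
  [MeasurableSpace V] [BorelSpace V] [NormedAddCommGroup W] [NormedSpace ℝ W]
  [SecondCountableTopology W] [MeasurableSpace W] [BorelSpace W]
  (μ : Measure V) [IsGaussian μ] (ν : Measure W) [IsGaussian ν]

theorem ProbabilityTheory.IsGaussian.covariance_fst_prod [SecondCountableTopology V]
    (l : StrongDual ℝ V) (L : StrongDual ℝ (V × W)) :
    cov[fun z : V × W => l z.1, L; μ.prod ν] = cov[l, fun x => L (x, 0); μ] := by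
  have h1 : MemLp (fun x : V => L (x, 0)) 2 μ :=
    IsGaussian.memLp_dual μ (L.comp (.inl ℝ V W)) 2 (by simp)
  have h2 : MemLp (fun y : W => L (0, y)) 2 ν :=
    IsGaussian.memLp_dual ν (L.comp (.inr ℝ V W)) 2 (by simp)
  have hl : MemLp l 2 μ := IsGaussian.memLp_dual μ l 2 (by simp)
  have hfst : MeasurePreserving Prod.fst (μ.prod ν) μ := measurePreserving_fst
  have hsnd : MeasurePreserving Prod.snd (μ.prod ν) ν := measurePreserving_snd
  have hL : (L : V × W → ℝ) = (fun x => L (x, 0)) ∘ Prod.fst + (fun y => L (0, y)) ∘ Prod.snd := by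
    ext z
    simp [← map_add]
  refine (congrArg (fun f => cov[l ∘ Prod.fst, f; μ.prod ν]) hL).trans ?_
  rw [covariance_add_right (hl.comp_measurePreserving hfst)
    (h1.comp_measurePreserving hfst) (h2.comp_measurePreserving hsnd)]
  have h0 : cov[l ∘ Prod.fst, (fun y => L (0, y)) ∘ Prod.snd; μ.prod ν] = 0 :=
    covariance_fst_snd_prod hl h2
  rw [h0, add_zero]
  conv_rhs => rw [← hfst.map_eq]
  rw [covariance_map (by fun_prop) (by fun_prop) (by fun_prop)]

theorem ProbabilityTheory.IsGaussian.covariance_snd_prod (l : StrongDual ℝ W)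
    (L : StrongDual ℝ (V × W)) :
    cov[fun z : V × W => l z.2, L; μ.prod ν] = cov[l, fun x => L (0, x); ν] := by
  have h1 : MemLp (fun x : V => L (x, 0)) 2 μ :=
    IsGaussian.memLp_dual μ (L.comp (.inl ℝ V W)) 2 (by simp)
  have h2 : MemLp (fun y : W => L (0, y)) 2 ν :=
    IsGaussian.memLp_dual ν (L.comp (.inr ℝ V W)) 2 (by simp)
  have hl : MemLp l 2 ν := IsGaussian.memLp_dual ν l 2 (by simp)
  have hfst : MeasurePreserving Prod.fst (μ.prod ν) μ := measurePreserving_fst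
  have hsnd : MeasurePreserving Prod.snd (μ.prod ν) ν := measurePreserving_snd
  have hL : (L : V × W → ℝ) = (fun x => L (x, 0)) ∘ Prod.fst + (fun y => L (0, y)) ∘ Prod.snd := by
    ext z
    simp [← map_add]
  have h0 : cov[(fun x => L (x, 0)) ∘ Prod.fst, l ∘ Prod.snd; μ.prod ν] = 0 :=
    covariance_fst_snd_prod h1 hl
  refine (congrArg (fun f => cov[l ∘ Prod.snd, f; μ.prod ν]) hL).trans ?_
  rw [covariance_add_right (hl.comp_measurePreserving hsnd)
    (h1.comp_measurePreserving hfst) (h2.comp_measurePreserving hsnd),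
    covariance_comm, h0, zero_add]
  conv_rhs => rw [← hsnd.map_eq]
  rw [covariance_map (by fun_prop) (by fun_prop) (by fun_prop)]

variable [SecondCountableTopology V] [CompleteSpace V] [CompleteSpace W]

theorem ProbabilityTheory.IsGaussian.integral_fst_mul_eq_integral_deriv
    (l : StrongDual ℝ V) (c : V) (hl : μ[l] = 0)
    (hc : ∀ L : StrongDual ℝ V, cov[l, L; μ] = L c) {φ φ' : V × W → ℝ}
    (hφ : PolyGrowth φ) (hφ' : PolyGrowth φ')
    (hd : ∀ z : V × W, HasDerivAt (fun t : ℝ => φ (z.1 + t • c, z.2)) (φ' z) 0) :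
    ∫ z, l z.1 * φ z ∂(μ.prod ν) = ∫ z, φ' z ∂(μ.prod ν) := by
  refine IsGaussian.integral_dual_mul_eq_integral_deriv (μ.prod ν) (l.comp (.fst ℝ V W)) (c, 0)
    ?_ (fun L => ?_) hφ hφ' (fun ⟨x, y⟩ => by simpa using hd (x, y))
  · have : (fun z => (l.comp (.fst ℝ V W)) z : V × W → ℝ) = fun z : V × W => l z.1 := rfl
    rw [this, integral_fun_fst (fun x => l x)]
    simpa using hl
  · exact (IsGaussian.covariance_fst_prod μ ν l L).trans (hc (L.comp (.inl ℝ V W)))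

theorem ProbabilityTheory.IsGaussian.integral_snd_mul_eq_integral_deriv
    (l : StrongDual ℝ W) (c : W) (hl : ν[l] = 0)
    (hc : ∀ L : StrongDual ℝ W, cov[l, L; ν] = L c) {φ φ' : V × W → ℝ}
    (hφ : PolyGrowth φ) (hφ' : PolyGrowth φ')
    (hd : ∀ z : V × W, HasDerivAt (fun t : ℝ => φ (z.1, z.2 + t • c)) (φ' z) 0) :
    ∫ z, l z.2 * φ z ∂(μ.prod ν) = ∫ z, φ' z ∂(μ.prod ν) := by
  refine IsGaussian.integral_dual_mul_eq_integral_deriv (μ.prod ν) (l.comp (.snd ℝ V W)) (0, c)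
    ?_ (fun L => ?_) hφ hφ' (fun ⟨x, y⟩ => by simpa using hd (x, y))
  · have : (fun z => (l.comp (.snd ℝ V W)) z : V × W → ℝ) = fun z : V × W => l z.2 := rfl
    rw [this, integral_fun_snd (fun x => l x)]
    simpa using hl
  · exact (IsGaussian.covariance_snd_prod μ ν l L).trans (hc (L.comp (.inr ℝ V W)))

end Product

/-! ### Centered Gaussian vectors with a given covariance matrix -/

section Coordinates

variable {ι : Type*} [Fintype ι]

/-- `μ` is a centered Gaussian measure on `ι → ℝ` with covariance matrix `S`. -/
structure IsCenteredGaussianWithCov (μ : Measure (ι → ℝ)) (S : ι → ι → ℝ) : Prop where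
  gaussian : IsGaussian μ
  mean : ∀ p, ∫ x, x p ∂μ = 0
  second : ∀ p q, ∫ x, x p * x q ∂μ = S p q

theorem ContinuousLinearMap.apply_eq_sum_single [DecidableEq ι] (L : StrongDual ℝ (ι → ℝ))
    (x : ι → ℝ) : L x = ∑ q, x q * L (Pi.single q 1) := by
  conv_lhs => rw [← Finset.univ_sum_single x]
  rw [map_sum]
  refine Finset.sum_congr rfl fun q _ => ?_
  have : (Pi.single q (x q) : ι → ℝ) = x q • Pi.single q 1 := by
    rw [← Pi.single_smul]; simp
  rw [this, map_smul, smul_eq_mul]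

theorem ContinuousLinearMap.exists_apply_eq_sum (L : StrongDual ℝ (ι → ℝ)) :
    ∃ a : ι → ℝ, ∀ x, L x = ∑ q, a q * x q := by
  classical
  exact ⟨fun q => L (Pi.single q 1), fun x => by simp only [L.apply_eq_sum_single x, mul_comm]⟩

namespace IsCenteredGaussianWithCov

variable {μ : Measure (ι → ℝ)} {S : ι → ι → ℝ}

theorem covariance_eval (h : IsCenteredGaussianWithCov μ S) (p : ι) (L : StrongDual ℝ (ι → ℝ)) :
    cov[(ContinuousLinearMap.proj p : (ι → ℝ) →L[ℝ] ℝ), L; μ] = L (S p) := by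
  have := h.gaussian
  have hm : ∀ q, MemLp (fun x : ι → ℝ => x q) 2 μ := fun q =>
    IsGaussian.memLp_dual μ (ContinuousLinearMap.proj q) 2 (by simp)
  obtain ⟨a, hL⟩ := L.exists_apply_eq_sum
  have hL' : (L : (ι → ℝ) → ℝ) = fun x => ∑ q, a q * x q := funext hL
  have hp : ((ContinuousLinearMap.proj p : (ι → ℝ) →L[ℝ] ℝ) : (ι → ℝ) → ℝ) = fun x => x p := rfl
  rw [hL (S p), hp, hL', covariance_fun_sum_right (fun q => (hm q).const_mul _) (hm p)]
  refine Finset.sum_congr rfl fun q _ => ?_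
  rw [covariance_const_mul_right, covariance_eq_sub (hm p) (hm q), h.mean, h.mean]
  simp [h.second]

theorem integral_mul_eq_integral_deriv (h : IsCenteredGaussianWithCov μ S) (p : ι)
    {φ φ' : (ι → ℝ) → ℝ} (hφ : PolyGrowth φ) (hφ' : PolyGrowth φ')
    (hd : ∀ z, HasDerivAt (fun t : ℝ => φ (z + t • S p)) (φ' z) 0) :
    ∫ z, z p * φ z ∂μ = ∫ z, φ' z ∂μ :=
  have := h.gaussian
  IsGaussian.integral_dual_mul_eq_integral_deriv μ (ContinuousLinearMap.proj p) (S p) (h.mean p)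
    (h.covariance_eval p) hφ hφ' hd

theorem polyGrowth_eval (p : ι) : PolyGrowth (fun x : ι → ℝ => x p) :=
  PolyGrowth.clm (ContinuousLinearMap.proj p : (ι → ℝ) →L[ℝ] ℝ)

/-- Isserlis' formula for four factors: integrate by parts in the coordinate `a` and differentiate
the product of the other three. -/
theorem integral_mul_mul_mul (h : IsCenteredGaussianWithCov μ S) (a b c d : ι) :
    ∫ x, x a * (x b * x c * x d) ∂μ = S a b * S c d + S a c * S b d + S a d * S b c := by
  have := h.gaussian
  have P := polyGrowth_eval (ι := ι)
  have hcoord : ∀ (z : ι → ℝ) q, HasDerivAt (fun t : ℝ => (z + t • S a) q) (S a q) 0 := by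
    intro z q
    simpa using ((hasDerivAt_id (0 : ℝ)).mul_const (S a q)).const_add (z q)
  rw [h.integral_mul_eq_integral_deriv a (((P b).mul (P c)).mul (P d))
    (φ' := fun x => S a b * (x c * x d) + S a c * (x b * x d) + S a d * (x b * x c))
    (((((P c).mul (P d)).const_mul _).add (((P b).mul (P d)).const_mul _)).add
      (((P b).mul (P c)).const_mul _)) ?_]
  · rw [integral_add ((((P c).mul (P d)).const_mul _).add
      (((P b).mul (P d)).const_mul _) |>.integrable μ) (((P b).mul (P c)).const_mul _ |>.integrable μ),
      integral_add (((P c).mul (P d)).const_mul _ |>.integrable μ)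
      (((P b).mul (P d)).const_mul _ |>.integrable μ)]
    simp only [integral_const_mul, h.second]
  · intro z
    refine (((hcoord z b).mul (hcoord z c)).mul (hcoord z d)).congr_deriv ?_
    simp
    ring

end IsCenteredGaussianWithCov

end Coordinates

/-! ### Toeplitz sums and the `ℓ^(4/3)` estimate -/

theorem sum_Icc_neg_succ (d : ℕ) (g : ℤ → ℝ) :
    ∑ k ∈ Finset.Icc (-((d + 1 : ℕ) : ℤ)) ((d + 1 : ℕ) : ℤ), g k =
      ∑ k ∈ Finset.Icc (-(d : ℤ)) d, g k + (g (d + 1) + g (-(d + 1))) := by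
  have h : Finset.Icc (-((d + 1 : ℕ) : ℤ)) ((d + 1 : ℕ) : ℤ) =
      insert ((d : ℤ) + 1) (insert (-((d : ℤ) + 1)) (Finset.Icc (-(d : ℤ)) d)) := by
    ext k
    simp only [Finset.mem_Icc, Finset.mem_insert]
    push_cast
    omega
  rw [h, Finset.sum_insert (by simp; omega), Finset.sum_insert (by simp)]
  ring

theorem sum_Icc_neg_eq (d : ℕ) (g : ℤ → ℝ) :
    ∑ k ∈ Finset.Icc (-(d : ℤ)) d, g k =
      g 0 + ∑ r ∈ Finset.range d, (g (r + 1) + g (-(r + 1))) := by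
  induction d with
  | zero => simp
  | succ d ih => rw [sum_Icc_neg_succ, ih, Finset.sum_range_succ]; ring

/-- The difference `k` is attained by `d - |k|` pairs. The endpoints `k = ±d` have weight zero, so
including them is harmless. The induction adds a last row and a last column to the square. -/
theorem sum_range_sum_range_sub (d : ℕ) (f : ℤ → ℝ) :
    ∑ r ∈ Finset.range d, ∑ t ∈ Finset.range d, f ((r : ℤ) - t) =
      ∑ k ∈ Finset.Icc (-(d : ℤ)) d, ((d : ℝ) - |(k : ℝ)|) * f k := by
  induction d with
  | zero => simp
  | succ d ih =>
    have h1 : ∑ r ∈ Finset.range d, f ((r : ℤ) - d) = ∑ r ∈ Finset.range d, f (-((r : ℤ) + 1)) := by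
      rw [← Finset.sum_range_reflect]
      refine Finset.sum_congr rfl fun r hr => ?_
      have := Finset.mem_range.1 hr
      congr 1
      omega
    have h2 : ∑ t ∈ Finset.range d, f ((d : ℤ) - t) = ∑ r ∈ Finset.range d, f ((r : ℤ) + 1) := by
      rw [← Finset.sum_range_reflect]
      refine Finset.sum_congr rfl fun r hr => ?_
      have := Finset.mem_range.1 hr
      congr 1
      omega
    have h3 : ∑ k ∈ Finset.Icc (-(d : ℤ)) d, (((d + 1 : ℕ) : ℝ) - |(k : ℝ)|) * f k =
        ∑ k ∈ Finset.Icc (-(d : ℤ)) d, ((d : ℝ) - |(k : ℝ)|) * f k +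
          ∑ k ∈ Finset.Icc (-(d : ℤ)) d, f k := by
      rw [← Finset.sum_add_distrib]
      refine Finset.sum_congr rfl fun k _ => ?_
      push_cast; ring
    have h4 : |(d : ℝ) + 1| = d + 1 := abs_of_nonneg (by positivity)
    rw [sum_Icc_neg_succ, h3, ← ih, sum_Icc_neg_eq, Finset.sum_range_succ]
    simp only [Finset.sum_range_succ, Finset.sum_add_distrib, h1, h2]
    push_cast
    rw [abs_neg, neg_add_rev] at *
    simp [h4]
    ring

theorem sum_fin_sum_fin_sub (d : ℕ) (f : ℤ → ℝ) :
    ∑ r : Fin d, ∑ t : Fin d, f ((r : ℤ) - t) =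
      ∑ k ∈ Finset.Icc (-(d : ℤ)) d, ((d : ℝ) - |(k : ℝ)|) * f k := by
  rw [← sum_range_sum_range_sub, Finset.sum_range]
  exact Finset.sum_congr rfl fun r _ =>
    (Finset.sum_range (fun t : ℕ => f (((r : ℕ) : ℤ) - t))).symm

theorem sum_fin_le_sum_Icc (d : ℕ) {f : ℤ → ℝ} (hf : ∀ k, 0 ≤ f k) {e : Fin d → ℤ}
    (he : Function.Injective e) (hmem : ∀ r, e r ∈ Finset.Icc (-(d : ℤ)) d) :
    ∑ r, f (e r) ≤ ∑ k ∈ Finset.Icc (-(d : ℤ)) d, f k := by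
  classical
  rw [← Finset.sum_image (f := f) (s := Finset.univ) (g := e) (fun _ _ _ _ h => he h)]
  refine Finset.sum_le_sum_of_subset_of_nonneg (fun k hk => ?_) fun k _ _ => hf k
  obtain ⟨r, -, rfl⟩ := Finset.mem_image.1 hk
  exact hmem r

/-- Young's inequality for kernels, by two applications of Cauchy–Schwarz. Splitting `x³y³ =
(x²y²)(xy)` leaves `∑ x⁴y⁴` and `∑ x²y²`; the latter is at most `A` by Cauchy–Schwarz again. Summing
`x⁴y⁴` over `r` and `t` first gives a column sum times a row sum for each `q`. Cubes avoid
fractional exponents. -/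
theorem sum_sq_sum_cube_mul_cube_le {ι : Type*} [Fintype ι] (p : ι → ι → ℝ) {A : ℝ} (hA : 0 ≤ A)
    (hrow : ∀ r, ∑ q, p r q ^ 4 ≤ A) (hcol : ∀ t, ∑ q, p q t ^ 4 ≤ A) :
    ∑ r, ∑ t, (∑ q, p r q ^ 3 * p q t ^ 3) ^ 2 ≤ Fintype.card ι * A ^ 3 := by
  have key : ∀ r t, (∑ q, p r q ^ 3 * p q t ^ 3) ^ 2 ≤ (∑ q, p r q ^ 4 * p q t ^ 4) * A := by
    intro r t
    have h1 : (∑ q, p r q ^ 3 * p q t ^ 3) ^ 2 ≤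
        (∑ q, (p r q ^ 2 * p q t ^ 2) ^ 2) * ∑ q, (p r q * p q t) ^ 2 := by
      refine le_trans (le_of_eq ?_) (Finset.sum_mul_sq_le_sq_mul_sq _ _ _)
      congr 1
      exact Finset.sum_congr rfl fun q _ => by ring
    have h2 : (∑ q, p r q ^ 2 * p q t ^ 2) ^ 2 ≤
        (∑ q, (p r q ^ 2) ^ 2) * ∑ q, (p q t ^ 2) ^ 2 :=
      Finset.sum_mul_sq_le_sq_mul_sq _ _ _
    have h3 : ∑ q, (p r q * p q t) ^ 2 ≤ A := by
      refine le_of_sq_le_sq ?_ hA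
      simp only [mul_pow]
      refine h2.trans ?_
      rw [sq A]
      refine mul_le_mul ?_ ?_ (by positivity) hA
      · simpa [← pow_mul] using hrow r
      · simpa [← pow_mul] using hcol t
    refine h1.trans ?_
    have h4 : ∑ q, (p r q ^ 2 * p q t ^ 2) ^ 2 = ∑ q, p r q ^ 4 * p q t ^ 4 :=
      Finset.sum_congr rfl fun q _ => by ring
    rw [h4]
    exact mul_le_mul_of_nonneg_left h3 (Finset.sum_nonneg fun q _ => by positivity)
  calc ∑ r, ∑ t, (∑ q, p r q ^ 3 * p q t ^ 3) ^ 2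
      ≤ ∑ r, ∑ t, (∑ q, p r q ^ 4 * p q t ^ 4) * A :=
        Finset.sum_le_sum fun r _ => Finset.sum_le_sum fun t _ => key r t
    _ = (∑ q, (∑ r, p r q ^ 4) * ∑ t, p q t ^ 4) * A := by
        simp only [← Finset.sum_mul]
        congr 1
        calc ∑ r, ∑ t, ∑ q, p r q ^ 4 * p q t ^ 4
            = ∑ r, ∑ q, ∑ t, p r q ^ 4 * p q t ^ 4 :=
              Finset.sum_congr rfl fun r _ => Finset.sum_comm
          _ = ∑ q, ∑ r, ∑ t, p r q ^ 4 * p q t ^ 4 := Finset.sum_comm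
          _ = _ := Finset.sum_congr rfl fun q _ => by rw [Finset.sum_mul_sum]
    _ ≤ (∑ _q : ι, A * A) * A := by
        refine mul_le_mul_of_nonneg_right (Finset.sum_le_sum fun q _ => ?_) hA
        exact mul_le_mul (hcol q) (hrow q) (Finset.sum_nonneg fun t _ => by positivity) hA
    _ = _ := by simp; ring

theorem sum_sq_sum_toeplitz_le (d : ℕ) (s : ℤ → ℝ) :
    ∑ r : Fin d, ∑ t : Fin d, (∑ q : Fin d, |s ((r : ℤ) - q)| * |s ((q : ℤ) - t)|) ^ 2 ≤
      d * (∑ k ∈ Finset.Icc (-(d : ℤ)) d, |s k| ^ ((4 : ℝ) / 3)) ^ 3 := by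
  -- The kernel estimate is applied to the cube roots `|s|^(1/3)`, whose fourth powers are
  -- `|s|^(4/3)`.
  have h3 : ∀ k, |s k| = (|s k| ^ ((1 : ℝ) / 3)) ^ 3 := fun k => by
    rw [← Real.rpow_natCast, ← Real.rpow_mul (abs_nonneg _)]
    norm_num
  have h4 : ∀ k, (|s k| ^ ((1 : ℝ) / 3)) ^ 4 = |s k| ^ ((4 : ℝ) / 3) := fun k => by
    rw [← Real.rpow_natCast, ← Real.rpow_mul (abs_nonneg _)]
    norm_num
  have hn : ∀ k, 0 ≤ |s k| ^ ((4 : ℝ) / 3) := fun k => by positivity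
  have := sum_sq_sum_cube_mul_cube_le (ι := Fin d)
    (fun r t => |s ((r : ℤ) - t)| ^ ((1 : ℝ) / 3))
    (A := ∑ k ∈ Finset.Icc (-(d : ℤ)) d, |s k| ^ ((4 : ℝ) / 3))
    (Finset.sum_nonneg fun k _ => hn k) (fun r => ?_) (fun t => ?_)
  · simpa only [← h3, Fintype.card_fin] using this
  · simp only [h4]
    refine sum_fin_le_sum_Icc d hn (e := fun q => (r : ℤ) - q) (fun a b h => ?_) fun q => ?_
    · simpa [Fin.ext_iff] using h
    · simp only [Finset.mem_Icc]; omega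
  · simp only [h4]
    refine sum_fin_le_sum_Icc d hn (e := fun q => (q : ℤ) - t) (fun a b h => ?_) fun q => ?_
    · simpa [Fin.ext_iff] using h
    · simp only [Finset.mem_Icc]; omega

/-! ### Integration by parts for the Wishart and Gaussian matrices -/

namespace WishartGaussian

open IsCenteredGaussianWithCov (polyGrowth_eval)

/-- The normalized Wishart matrix, as a function of the entries of the data matrix. -/
noncomputable def wishartMap (n d : ℕ) (x : Fin n × Fin d → ℝ) (p : Fin n × Fin n) : ℝ :=
  (√(d : ℝ))⁻¹ * ∑ k, x (p.1, k) * x (p.2, k) - √(d : ℝ) * if p.1 = p.2 then 1 else 0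

/-- The covariance of a data matrix with independent stationary rows. -/
def rowCov (n d : ℕ) (s : ℤ → ℝ) (p q : Fin n × Fin d) : ℝ :=
  if p.1 = q.1 then s ((p.2 : ℤ) - q.2) else 0

/-- The covariance of the entries of a symmetric Gaussian matrix whose off-diagonal entries have
variance `v`. -/
def goeCov (n : ℕ) (v : ℝ) (p q : Fin n × Fin n) : ℝ :=
  v * ((if p = q then 1 else 0) + if p.swap = q then 1 else 0)

/-- The random matrix `d⁻¹ X S Xᵀ` with `S = (s (k - r))`. -/
noncomputable def weightedGram {n d : ℕ} (s : ℤ → ℝ) (x : Fin n × Fin d → ℝ) (j l : Fin n) : ℝ :=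
  (d : ℝ)⁻¹ * ∑ k : Fin d, ∑ r : Fin d, s ((k : ℤ) - r) * (x (j, k) * x (l, r))

/-- The symmetrized matrix unit. -/
def symmUnit {n : ℕ} (i l : Fin n) : Fin n × Fin n → ℝ :=
  Pi.single (i, l) 1 + Pi.single (l, i) 1

/-- A point of the interpolation between the Wishart matrix and its Gaussian counterpart. -/
noncomputable def interp {n d : ℕ} (a b : ℝ)
    (z : (Fin n × Fin d → ℝ) × (Fin n × Fin n → ℝ)) : Fin n × Fin n → ℝ :=
  a • wishartMap n d z.1 + b • z.2

theorem continuous_wishartMap (n d : ℕ) : Continuous (wishartMap n d) := by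
  unfold wishartMap
  fun_prop

theorem continuous_interp {n d : ℕ} (a b : ℝ) : Continuous (interp (n := n) (d := d) a b) :=
  (((continuous_wishartMap n d).comp continuous_fst).const_smul a).add
    (continuous_snd.const_smul b)

/-- Integration by parts in the entry `(i, l)` of `G` differentiates along this vector. The Wishart
side also produces the directions `symmUnit i l`, which is why the two Hessian terms can be
compared. -/
theorem goeCov_eq_smul_symmUnit {n : ℕ} (v : ℝ) (i l : Fin n) :
    goeCov n v (i, l) = v • symmUnit i l := by
  ext q
  simp [goeCov, symmUnit, Pi.single_apply, eq_comm]

theorem sum_mul_symmUnit {n : ℕ} (i : Fin n) (y : Fin n → ℝ) :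
    ∑ l, y l • symmUnit i l = fun p : Fin n × Fin n =>
      (if i = p.1 then y p.2 else 0) + if i = p.2 then y p.1 else 0 := by
  ext ⟨p, q⟩
  simp only [symmUnit, Finset.sum_apply, Pi.smul_apply, Pi.add_apply, Pi.single_apply,
    Prod.mk.injEq, smul_eq_mul, mul_add, Finset.sum_add_distrib, mul_ite, mul_one, mul_zero]
  congr 1
  · by_cases h : i = p
    · simp [h]
    · simp [h, Ne.symm h]
  · by_cases h : i = q
    · simp [h]
    · simp [h, Ne.symm h]

theorem hasDerivAt_wishartMap {n d : ℕ} (s : ℤ → ℝ) (x : Fin n × Fin d → ℝ) (i : Fin n)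
    (k : Fin d) :
    HasDerivAt (fun t : ℝ => wishartMap n d (x + t • rowCov n d s (i, k)))
      (∑ l, ((√(d : ℝ))⁻¹ * ∑ r : Fin d, s ((k : ℤ) - r) * x (l, r)) • symmUnit i l) 0 := by
  rw [sum_mul_symmUnit, hasDerivAt_pi]
  intro p
  have hc : ∀ q : Fin n × Fin d, HasDerivAt (fun t : ℝ => (x + t • rowCov n d s (i, k)) q)
      (rowCov n d s (i, k) q) 0 := by
    intro q
    simpa using ((hasDerivAt_id (0 : ℝ)).mul_const (rowCov n d s (i, k) q)).const_add (x q)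
  have h1 : HasDerivAt (fun t : ℝ => wishartMap n d (x + t • rowCov n d s (i, k)) p)
      ((√(d : ℝ))⁻¹ * ∑ r, (rowCov n d s (i, k) (p.1, r) * x (p.2, r) +
        x (p.1, r) * rowCov n d s (i, k) (p.2, r))) 0 := by
    have := ((HasDerivAt.fun_sum (u := Finset.univ) fun r _ => (hc (p.1, r)).mul
      (hc (p.2, r))).const_mul ((√(d : ℝ))⁻¹)).sub_const
      (√(d : ℝ) * if p.1 = p.2 then 1 else 0)
    refine this.congr_deriv ?_
    simp
  refine h1.congr_deriv ?_
  simp only [rowCov, Finset.sum_add_distrib, mul_add]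
  congr 1
  · by_cases h : i = p.1 <;> simp [h]
  · by_cases h : i = p.2 <;> simp [h, mul_comm]

section TestFunction

variable {n d : ℕ} {h : (Fin n × Fin n → ℝ) → ℝ} {K : ℝ}

theorem polyGrowth_fderiv_interp (hC : ContDiff ℝ 2 h)
    (hL : ∀ x v, |fderiv ℝ h x v| ≤ √(∑ p, v p ^ 2)) (a b : ℝ) (v : Fin n × Fin n → ℝ) :
    PolyGrowth (fun z : (Fin n × Fin d → ℝ) × (Fin n × Fin n → ℝ) =>
      fderiv ℝ h (interp a b z) v) :=
  .of_bounded (((hC.continuous_fderiv (by norm_num)).comp (continuous_interp a b)).clm_apply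
    continuous_const) fun _ => hL _ _

theorem polyGrowth_fderiv_fderiv_interp (hC : ContDiff ℝ 2 h)
    (hH : ∀ x, ‖fderiv ℝ (fderiv ℝ h) x‖ ≤ K) (a b : ℝ) (u v : Fin n × Fin n → ℝ) :
    PolyGrowth (fun z : (Fin n × Fin d → ℝ) × (Fin n × Fin n → ℝ) =>
      fderiv ℝ (fderiv ℝ h) (interp a b z) u v) := by
  refine .of_bounded (C := K * ‖u‖ * ‖v‖) ?_ fun z => ?_
  · have h1 : Continuous (fderiv ℝ (fderiv ℝ h)) :=
      (hC.fderiv_right (m := 1) (by norm_num)).continuous_fderiv (by norm_num)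
    exact ((h1.comp (continuous_interp a b)).clm_apply continuous_const).clm_apply continuous_const
  · rw [← Real.norm_eq_abs]
    refine (ContinuousLinearMap.le_opNorm₂ _ u v).trans ?_
    gcongr
    exact hH _

theorem hasDerivAt_fderiv_comp (hC : ContDiff ℝ 2 h) {γ : ℝ → Fin n × Fin n → ℝ}
    {w x v : Fin n × Fin n → ℝ} (hγ : HasDerivAt γ w 0) (hx : γ 0 = x) :
    HasDerivAt (fun t => fderiv ℝ h (γ t) v) (fderiv ℝ (fderiv ℝ h) x w v) 0 := by
  have h1 : HasFDerivAt (fderiv ℝ h) (fderiv ℝ (fderiv ℝ h) x) (γ 0) := by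
    rw [hx]
    exact ((hC.fderiv_right (m := 1) (by norm_num)).differentiable (by norm_num) x).hasFDerivAt
  have h2 := h1.comp_hasDerivAt (0 : ℝ) hγ
  simpa using h2.clm_apply (hasDerivAt_const (0 : ℝ) v)

theorem polyGrowth_weightedGram (s : ℤ → ℝ) (j l : Fin n) :
    PolyGrowth (fun x : Fin n × Fin d → ℝ => weightedGram s x j l) :=
  (PolyGrowth.sum _ fun _ _ => .sum _ fun _ _ =>
    ((polyGrowth_eval _).mul (polyGrowth_eval _)).const_mul _).const_mul _

theorem polyGrowth_wishartMap (p : Fin n × Fin n) :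
    PolyGrowth (fun x : Fin n × Fin d → ℝ => wishartMap n d x p) :=
  ((PolyGrowth.sum _ fun _ _ => (polyGrowth_eval _).mul (polyGrowth_eval _)).const_mul _).sub
    (.const _)

variable {s : ℤ → ℝ} {μ : Measure (Fin n × Fin d → ℝ)} {ν : Measure (Fin n × Fin n → ℝ)} {v : ℝ}

/-- Integrate by parts in the factor `X i k` of each summand `X i k * X j k`. Differentiating `X j
k` gives the mean of the product, which cancels the centering of the Wishart matrix; differentiating
`∇h` gives the Hessian, and the sum over `k` assembles `d⁻¹ X S Xᵀ`. -/
theorem integral_wishartMap_mul_fderiv (hs0 : s 0 = 1) (hd : 1 ≤ d)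
    (hμ : IsCenteredGaussianWithCov μ (rowCov n d s)) [IsGaussian ν] (hC : ContDiff ℝ 2 h)
    (hL : ∀ x v, |fderiv ℝ h x v| ≤ √(∑ p, v p ^ 2))
    (hH : ∀ x, ‖fderiv ℝ (fderiv ℝ h) x‖ ≤ K) (a b : ℝ) (i j : Fin n) :
    ∫ z, wishartMap n d z.1 (i, j) * fderiv ℝ h (interp a b z) (Pi.single (i, j) 1) ∂(μ.prod ν) =
      a * ∑ l, ∫ z, weightedGram s z.1 j l *
        fderiv ℝ (fderiv ℝ h) (interp a b z) (symmUnit i l) (Pi.single (i, j) 1)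
          ∂(μ.prod ν) := by
  have := hμ.gaussian
  set D := fun z : (Fin n × Fin d → ℝ) × (Fin n × Fin n → ℝ) =>
    fderiv ℝ h (interp a b z) (Pi.single (i, j) 1) with hD
  set H := fun (l : Fin n) (z : (Fin n × Fin d → ℝ) × (Fin n × Fin n → ℝ)) =>
    fderiv ℝ (fderiv ℝ h) (interp a b z) (symmUnit i l) (Pi.single (i, j) 1) with hHd
  have PD : PolyGrowth D := polyGrowth_fderiv_interp hC hL a b _
  have PH : ∀ l, PolyGrowth (H l) := fun l => polyGrowth_fderiv_fderiv_interp hC hH a b _ _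
  have Px : ∀ q, PolyGrowth (fun z : (Fin n × Fin d → ℝ) × (Fin n × Fin n → ℝ) => z.1 q) :=
    fun q => (polyGrowth_eval q).comp_fst
  let y : Fin d → Fin n → (Fin n × Fin d → ℝ) × (Fin n × Fin n → ℝ) → ℝ :=
    fun k l z => ∑ r : Fin d, s ((k : ℤ) - r) * z.1 (l, r)
  have Py : ∀ k l, PolyGrowth (y k l) := fun k l => .sum _ fun r _ => (Px _).const_mul _
  have hibp : ∀ k, ∫ z, z.1 (i, k) * (z.1 (j, k) * D z) ∂(μ.prod ν) =
      ∫ z, ((if i = j then 1 else 0) * D z +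
        z.1 (j, k) * ∑ l, a * (√(d : ℝ))⁻¹ * y k l z * H l z) ∂(μ.prod ν) := by
    intro k
    refine IsGaussian.integral_fst_mul_eq_integral_deriv μ ν (ContinuousLinearMap.proj (i, k))
      (rowCov n d s (i, k)) (hμ.mean _) (hμ.covariance_eval _) ((Px _).mul PD)
      ((PD.const_mul _).add ((Px _).mul (.sum _ fun l _ => ((Py k l).const_mul _).mul (PH l))))
      fun z => ?_
    have h1 : HasDerivAt (fun t : ℝ => (z.1 + t • rowCov n d s (i, k)) (j, k))
        (if i = j then 1 else 0) 0 := by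
      have := ((hasDerivAt_id (0 : ℝ)).mul_const (rowCov n d s (i, k) (j, k))).const_add
        (z.1 (j, k))
      simpa [rowCov, hs0] using this
    have h2 : HasDerivAt (fun t : ℝ => interp a b (z.1 + t • rowCov n d s (i, k), z.2))
        (a • ∑ l, ((√(d : ℝ))⁻¹ * y k l z) • symmUnit i l) 0 :=
      ((hasDerivAt_wishartMap s z.1 i k).const_smul a).add_const (b • z.2)
    have h3 := hasDerivAt_fderiv_comp (v := Pi.single (i, j) 1) hC h2 (x := interp a b z) (by simp)
    refine (h1.mul h3).congr_deriv ?_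
    simp only [map_smul, map_sum, smul_apply, sum_apply,
      smul_eq_mul, hD, hHd, zero_smul, add_zero, Finset.mul_sum, mul_assoc]
  have hd0 : (0 : ℝ) < d := by exact_mod_cast hd
  have hsq : √(d : ℝ) * √(d : ℝ) = d := Real.mul_self_sqrt hd0.le
  have hsp : 0 < √(d : ℝ) := Real.sqrt_pos.2 hd0
  have hsi : (√(d : ℝ))⁻¹ * (√(d : ℝ))⁻¹ = (d : ℝ)⁻¹ := by rw [← mul_inv, hsq]
  have hW : ∀ z : (Fin n × Fin d → ℝ) × (Fin n × Fin n → ℝ), wishartMap n d z.1 (i, j) * D z =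
      (√(d : ℝ))⁻¹ * ∑ k, z.1 (i, k) * (z.1 (j, k) * D z) -
        (√(d : ℝ) * if i = j then 1 else 0) * D z := by
    intro z
    simp only [wishartMap, sub_mul, mul_assoc, Finset.sum_mul]
  have i1 : ∀ k, PolyGrowth (fun z : (Fin n × Fin d → ℝ) × (Fin n × Fin n → ℝ) =>
      z.1 (i, k) * (z.1 (j, k) * D z)) := fun k => (Px _).mul ((Px _).mul PD)
  have i2 : ∀ k, PolyGrowth (fun z : (Fin n × Fin d → ℝ) × (Fin n × Fin n → ℝ) =>
      z.1 (j, k) * ∑ l, a * (√(d : ℝ))⁻¹ * y k l z * H l z) := fun k =>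
    (Px _).mul (.sum _ fun l _ => ((Py k l).const_mul _).mul (PH l))
  calc ∫ z, wishartMap n d z.1 (i, j) * D z ∂(μ.prod ν)
      = (√(d : ℝ))⁻¹ * ∑ k, ∫ z, z.1 (i, k) * (z.1 (j, k) * D z) ∂(μ.prod ν) -
        (√(d : ℝ) * if i = j then 1 else 0) * ∫ z, D z ∂(μ.prod ν) := by
        simp only [hW]
        rw [integral_sub (((PolyGrowth.sum _ fun k _ => i1 k).const_mul _).integrable _)
          ((PD.const_mul _).integrable _), integral_const_mul, integral_const_mul,
          integral_finsetSum _ fun k _ => (i1 k).integrable _]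
    _ = (√(d : ℝ))⁻¹ * ∑ k, ∫ z, z.1 (j, k) * ∑ l, a * (√(d : ℝ))⁻¹ * y k l z * H l z
          ∂(μ.prod ν) := by
        have : ∀ k, ∫ z, z.1 (i, k) * (z.1 (j, k) * D z) ∂(μ.prod ν) =
            (if i = j then 1 else 0) * ∫ z, D z ∂(μ.prod ν) +
            ∫ z, z.1 (j, k) * ∑ l, a * (√(d : ℝ))⁻¹ * y k l z * H l z ∂(μ.prod ν) := fun k => by
          rw [hibp k, integral_add ((PD.const_mul _).integrable _) ((i2 k).integrable _),
            integral_const_mul]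
        simp only [this, Finset.sum_add_distrib, Finset.sum_const, Finset.card_univ,
          Fintype.card_fin, nsmul_eq_mul]
        -- The `d` equal terms `1_{i = j} ∫ D`, normalized by `1 / √d`, are exactly the centering
        -- `√d 1_{i = j} ∫ D`.
        have e : (√(d : ℝ))⁻¹ * d = √(d : ℝ) := by
          rw [inv_mul_eq_iff_eq_mul₀ hsp.ne', hsq]
        rw [mul_add, ← mul_assoc, e]
        ring
    _ = ∫ z, ∑ l, a * (weightedGram s z.1 j l * H l z) ∂(μ.prod ν) := by
        rw [← integral_finsetSum _ fun k _ => (i2 k).integrable _, ← integral_const_mul]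
        refine integral_congr_ae (.of_forall fun z => ?_)
        simp only [weightedGram, ← hsi, y, Finset.mul_sum, Finset.sum_mul]
        rw [Finset.sum_comm]
        refine Finset.sum_congr rfl fun l _ => Finset.sum_congr rfl fun k _ =>
          Finset.sum_congr rfl fun r _ => ?_
        ring
    _ = _ := by
        rw [integral_finsetSum _ fun l _ =>
          (((polyGrowth_weightedGram s j l).comp_fst.mul (PH l)).const_mul a).integrable _,
          Finset.mul_sum]
        simp only [integral_const_mul, hHd]

/-- The weight `m` depends on `X` alone, so it is a constant for integration by parts in `G`. The
case `m = 1` handles `E⟨G, ∇h⟩`; the entries of `M - v I` as weights remove the Hessian. -/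
theorem integral_snd_mul_mul_fderiv [IsGaussian μ] (hν : IsCenteredGaussianWithCov ν (goeCov n v))
    (hC : ContDiff ℝ 2 h) (hL : ∀ x v, |fderiv ℝ h x v| ≤ √(∑ p, v p ^ 2))
    (hH : ∀ x, ‖fderiv ℝ (fderiv ℝ h) x‖ ≤ K) (a b : ℝ) (i l : Fin n) (e : Fin n × Fin n → ℝ)
    {m : (Fin n × Fin d → ℝ) → ℝ} (hm : PolyGrowth m) :
    ∫ z, z.2 (i, l) * (m z.1 * fderiv ℝ h (interp a b z) e) ∂(μ.prod ν) =
      b * v * ∫ z, m z.1 * fderiv ℝ (fderiv ℝ h) (interp a b z) (symmUnit i l) e ∂(μ.prod ν) := by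
  have := hν.gaussian
  rw [← integral_const_mul]
  refine IsGaussian.integral_snd_mul_eq_integral_deriv μ ν (ContinuousLinearMap.proj (i, l))
    (goeCov n v (i, l)) (hν.mean _) (hν.covariance_eval _)
    (hm.comp_fst.mul (polyGrowth_fderiv_interp hC hL a b _))
    ((hm.comp_fst.mul (polyGrowth_fderiv_fderiv_interp hC hH a b _ _)).const_mul _) fun z => ?_
  have h2 : HasDerivAt (fun t : ℝ => interp a b (z.1, z.2 + t • goeCov n v (i, l)))
      (b • (v • symmUnit i l)) 0 := by
    have h1 : HasDerivAt (fun t : ℝ => z.2 + t • goeCov n v (i, l)) (goeCov n v (i, l)) 0 := by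
      simpa using ((hasDerivAt_id (0 : ℝ)).smul_const (goeCov n v (i, l))).const_add z.2
    rw [← goeCov_eq_smul_symmUnit]
    exact (h1.const_smul b).const_add (a • wishartMap n d z.1)
  have h3 := hasDerivAt_fderiv_comp (v := e) hC h2 (x := interp a b z) (by simp)
  refine (h3.const_mul (m z.1)).congr_deriv ?_
  simp only [map_smul, smul_apply, smul_eq_mul]
  ring

end TestFunction

end WishartGaussian

/-! ### Interpolation between the Wishart matrix and its Gaussian counterpart -/

theorem integral_sqrt_le_sqrt_integral {Ω : Type*} [MeasurableSpace Ω] (μ : Measure Ω)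
    [IsProbabilityMeasure μ] {f : Ω → ℝ} (hf : Integrable f μ) (h0 : ∀ x, 0 ≤ f x) :
    ∫ x, √(f x) ∂μ ≤ √(∫ x, f x ∂μ) := by
  have hm : AEStronglyMeasurable (fun x => √(f x)) μ :=
    Real.continuous_sqrt.comp_aestronglyMeasurable hf.1
  have h2 : MemLp (fun x => √(f x)) 2 μ := by
    rw [memLp_two_iff_integrable_sq hm]
    exact hf.congr (.of_forall fun x => (Real.sq_sqrt (h0 x)).symm)
  have hv := variance_nonneg (fun x => √(f x)) μ
  rw [variance_eq_sub h2] at hv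
  refine Real.le_sqrt_of_sq_le ?_
  have : ∫ x, ((fun x => √(f x)) ^ 2) x ∂μ = ∫ x, f x ∂μ :=
    integral_congr_ae (.of_forall fun x => Real.sq_sqrt (h0 x))
  linarith

namespace WishartGaussian

open IsCenteredGaussianWithCov (polyGrowth_eval)

section Interpolation

variable {n d : ℕ} {h : (Fin n × Fin n → ℝ) → ℝ} {K : ℝ}
  {s : ℤ → ℝ} {μ : Measure (Fin n × Fin d → ℝ)} {ν : Measure (Fin n × Fin n → ℝ)} {v : ℝ}

/-- The deviation of `d⁻¹ X S Xᵀ` from its expectation, multiplied by the Gaussian matrix. -/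
noncomputable def stein (v : ℝ) (s : ℤ → ℝ) (z : (Fin n × Fin d → ℝ) × (Fin n × Fin n → ℝ))
    (p : Fin n × Fin n) : ℝ :=
  ∑ l, z.2 (p.1, l) * (weightedGram s z.1 p.2 l - v * if p.2 = l then 1 else 0)

theorem polyGrowth_stein (p : Fin n × Fin n) :
    PolyGrowth (fun z : (Fin n × Fin d → ℝ) × (Fin n × Fin n → ℝ) => stein v s z p) :=
  .sum _ fun _ _ => (polyGrowth_eval _).comp_snd.mul
    ((polyGrowth_weightedGram s _ _).comp_fst.sub (.const _))

/-- Both sides equal `a b` times the expected pairing of `M - v I` with the Hessian. On the right,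
integration by parts in `G` yields the factor `b v`, so no division by `b` occurs and the identity
stays usable where `b = cos θ` vanishes. -/
theorem sum_integral_eq_sum_integral_stein (hs0 : s 0 = 1) (hd : 1 ≤ d) (hv : 0 < v)
    (hμ : IsCenteredGaussianWithCov μ (rowCov n d s))
    (hν : IsCenteredGaussianWithCov ν (goeCov n v)) (hC : ContDiff ℝ 2 h)
    (hL : ∀ x v, |fderiv ℝ h x v| ≤ √(∑ p, v p ^ 2))
    (hH : ∀ x, ‖fderiv ℝ (fderiv ℝ h) x‖ ≤ K) (a b : ℝ) :
    b * ∑ p, ∫ z, wishartMap n d z.1 p * fderiv ℝ h (interp a b z) (Pi.single p 1) ∂(μ.prod ν) -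
      a * ∑ p, ∫ z, z.2 p * fderiv ℝ h (interp a b z) (Pi.single p 1) ∂(μ.prod ν) =
    a / v * ∑ p, ∫ z, stein v s z p * fderiv ℝ h (interp a b z) (Pi.single p 1) ∂(μ.prod ν) := by
  have := hμ.gaussian
  have := hν.gaussian
  have hst : ∀ p : Fin n × Fin n,
      ∫ z, stein v s z p * fderiv ℝ h (interp a b z) (Pi.single p 1) ∂(μ.prod ν) =
      b * v * (∑ l, ∫ z, weightedGram s z.1 p.2 l *
        fderiv ℝ (fderiv ℝ h) (interp a b z) (symmUnit p.1 l) (Pi.single p 1) ∂(μ.prod ν) -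
        v * ∫ z, fderiv ℝ (fderiv ℝ h) (interp a b z) (symmUnit p.1 p.2) (Pi.single p 1)
          ∂(μ.prod ν)) := by
    intro p
    have hm : ∀ l, PolyGrowth (fun x : Fin n × Fin d → ℝ =>
        weightedGram s x p.2 l - v * if p.2 = l then 1 else 0) := fun l =>
      (polyGrowth_weightedGram s _ _).sub (.const _)
    have hterm : ∀ l, ∫ z, (weightedGram s z.1 p.2 l - v * if p.2 = l then 1 else 0) *
        fderiv ℝ (fderiv ℝ h) (interp a b z) (symmUnit p.1 l) (Pi.single p 1) ∂(μ.prod ν) =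
        ∫ z, weightedGram s z.1 p.2 l *
          fderiv ℝ (fderiv ℝ h) (interp a b z) (symmUnit p.1 l) (Pi.single p 1) ∂(μ.prod ν) -
        (if p.2 = l then 1 else 0) * (v * ∫ z,
          fderiv ℝ (fderiv ℝ h) (interp a b z) (symmUnit p.1 l) (Pi.single p 1) ∂(μ.prod ν)) := by
      intro l
      have PH := polyGrowth_fderiv_fderiv_interp (d := d) hC hH a b (symmUnit p.1 l)
        (Pi.single p 1)
      simp only [sub_mul]
      rw [integral_sub (((polyGrowth_weightedGram s _ _).comp_fst.mul PH).integrable _)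
        ((PH.const_mul _).integrable _), integral_const_mul]
      ring
    calc ∫ z, stein v s z p * fderiv ℝ h (interp a b z) (Pi.single p 1) ∂(μ.prod ν)
        = ∑ l, ∫ z, z.2 (p.1, l) * ((weightedGram s z.1 p.2 l - v * if p.2 = l then 1 else 0) *
            fderiv ℝ h (interp a b z) (Pi.single p 1)) ∂(μ.prod ν) := by
          rw [← integral_finsetSum]
          · simp only [stein, Finset.sum_mul, mul_assoc]
          · exact fun l _ => ((polyGrowth_eval _).comp_snd.mul ((hm l).comp_fst.mul
              (polyGrowth_fderiv_interp hC hL a b _))).integrable _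
      _ = _ := by
          simp only [fun l => integral_snd_mul_mul_fderiv (μ := μ) hν hC hL hH a b p.1 l
            (Pi.single p 1) (hm l), hterm, ← Finset.mul_sum, Finset.sum_sub_distrib, ite_mul,
            one_mul, zero_mul, Finset.sum_ite_eq, Finset.mem_univ, if_true]
  have hG : ∀ p : Fin n × Fin n,
      ∫ z, z.2 p * fderiv ℝ h (interp a b z) (Pi.single p 1) ∂(μ.prod ν) =
      b * v * ∫ z, fderiv ℝ (fderiv ℝ h) (interp a b z) (symmUnit p.1 p.2) (Pi.single p 1)
          ∂(μ.prod ν) := by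
    intro p
    simpa using integral_snd_mul_mul_fderiv (μ := μ) hν hC hL hH a b p.1 p.2
      (Pi.single p 1) (PolyGrowth.const 1)
  have hW := fun p : Fin n × Fin n =>
    integral_wishartMap_mul_fderiv (ν := ν) hs0 hd hμ hC hL hH a b p.1 p.2
  simp only [Prod.mk.eta] at hW
  simp only [hst, hG, hW, ← Finset.mul_sum, Finset.sum_sub_distrib]
  field_simp

theorem fderiv_eq_sum (x w : Fin n × Fin n → ℝ) :
    fderiv ℝ h x w = ∑ p, w p * fderiv ℝ h x (Pi.single p 1) :=
  (fderiv ℝ h x).apply_eq_sum_single w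

theorem hasDerivAt_integral_interp [IsGaussian μ] [IsGaussian ν] (hC : ContDiff ℝ 2 h)
    (hL : ∀ x v, |fderiv ℝ h x v| ≤ √(∑ p, v p ^ 2)) (θ : ℝ) :
    HasDerivAt (fun θ => ∫ z, h (interp (Real.sin θ) (Real.cos θ) z) ∂(μ.prod ν))
      (Real.cos θ * ∑ p, ∫ z, wishartMap n d z.1 p *
          fderiv ℝ h (interp (Real.sin θ) (Real.cos θ) z) (Pi.single p 1) ∂(μ.prod ν) -
        Real.sin θ * ∑ p, ∫ z, z.2 p *
          fderiv ℝ h (interp (Real.sin θ) (Real.cos θ) z) (Pi.single p 1) ∂(μ.prod ν)) θ := by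
  have hdiff := hC.differentiable (by norm_num)
  let w : ℝ → (Fin n × Fin d → ℝ) × (Fin n × Fin n → ℝ) → Fin n × Fin n → ℝ :=
    fun θ z => Real.cos θ • wishartMap n d z.1 - Real.sin θ • z.2
  have Pw : ∀ θ p, PolyGrowth (fun z => w θ z p) := fun θ p =>
    ((polyGrowth_wishartMap p).comp_fst.const_mul _).sub ((polyGrowth_eval p).comp_snd.const_mul _)
  -- The Euclidean norm is at most the `ℓ¹` norm; the latter is easier to dominate and to integrate
  -- entry by entry.
  have hbd : ∀ x u, |fderiv ℝ h x u| ≤ ∑ p, |u p| := fun x u => by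
    refine (hL x u).trans (Real.sqrt_le_iff.2 ⟨Finset.sum_nonneg fun p _ => abs_nonneg _, ?_⟩)
    simpa using Finset.sum_sq_le_sq_sum_of_nonneg (s := Finset.univ) (f := fun p => |u p|)
      fun p _ => abs_nonneg _
  have hgrowth : ∀ x, |h x| ≤ |h 0| + Fintype.card (Fin n × Fin n) * ∑ p, |x p| := by
    intro x
    have hb : ∀ x, ‖fderiv ℝ h x‖ ≤ Fintype.card (Fin n × Fin n) := fun x => by
      refine ContinuousLinearMap.opNorm_le_bound _ (by positivity) fun u => (hbd x u).trans ?_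
      calc ∑ p, |u p| ≤ ∑ _p : Fin n × Fin n, ‖u‖ :=
            Finset.sum_le_sum fun p _ => norm_le_pi_norm u p
        _ = _ := by simp
    have h1 := (convex_univ (𝕜 := ℝ)).norm_image_sub_le_of_norm_fderiv_le (f := h) (𝕜 := ℝ)
      (x := 0) (y := x) (fun x _ => hdiff x) (fun x _ => hb x) (Set.mem_univ _) (Set.mem_univ _)
    rw [sub_zero, Real.norm_eq_abs] at h1
    have h2 := abs_sub_abs_le_abs_sub (h x) (h 0)
    have h3 : ‖x‖ ≤ ∑ p, |x p| :=
      (pi_norm_le_iff_of_nonneg (Finset.sum_nonneg fun p _ => abs_nonneg _)).2 fun p =>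
        Finset.single_le_sum (f := fun p => |x p|) (fun p _ => abs_nonneg _) (Finset.mem_univ p)
    have h4 := mul_le_mul_of_nonneg_left h3
      (by positivity : (0 : ℝ) ≤ Fintype.card (Fin n × Fin n))
    linarith
  have PW : ∀ p, PolyGrowth (fun z : (Fin n × Fin d → ℝ) × (Fin n × Fin n → ℝ) =>
      wishartMap n d z.1 p) := fun p => (polyGrowth_wishartMap p).comp_fst
  have PG : ∀ p, PolyGrowth (fun z : (Fin n × Fin d → ℝ) × (Fin n × Fin n → ℝ) => z.2 p) :=
    fun p => (polyGrowth_eval p).comp_snd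
  have PD := fun p => polyGrowth_fderiv_interp (d := d) hC hL (Real.sin θ) (Real.cos θ)
    (Pi.single p 1)
  have Pint : Integrable (fun z => h (interp (Real.sin θ) (Real.cos θ) z)) (μ.prod ν) := by
    refine Integrable.mono' (g := fun z => |h 0| + Fintype.card (Fin n × Fin n) *
      ∑ p, |interp (Real.sin θ) (Real.cos θ) z p|) ?_
      (hC.continuous.comp (continuous_interp _ _)).aestronglyMeasurable
      (.of_forall fun z => hgrowth _)
    refine (integrable_const _).add (Integrable.const_mul (integrable_finsetSum _ fun p _ => ?_) _)
    exact ((((PW p).const_mul (Real.sin θ)).add ((PG p).const_mul (Real.cos θ))).integrable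
      (μ.prod ν)).abs
  have key := hasDerivAt_integral_of_dominated_loc_of_deriv_le (μ := μ.prod ν) (x₀ := θ)
    (F := fun θ z => h (interp (Real.sin θ) (Real.cos θ) z))
    (F' := fun θ z => fderiv ℝ h (interp (Real.sin θ) (Real.cos θ) z) (w θ z))
    (bound := fun z => ∑ p, (|wishartMap n d z.1 p| + |z.2 p|)) Filter.univ_mem
    (.of_forall fun θ => (hC.continuous.comp (continuous_interp _ _)).aestronglyMeasurable)
    Pint ?_ ?_ ?_ ?_
  · refine key.2.congr_deriv ?_
    simp only [fderiv_eq_sum _ (w θ _)]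
    rw [integral_finsetSum _ fun p _ => ((Pw θ p).mul (PD p)).integrable _, Finset.mul_sum,
      Finset.mul_sum, ← Finset.sum_sub_distrib]
    refine Finset.sum_congr rfl fun p _ => ?_
    rw [← integral_const_mul, ← integral_const_mul, ← integral_sub
      ((((PW p).mul (PD p)).const_mul _).integrable _)
      ((((PG p).mul (PD p)).const_mul _).integrable _)]
    refine integral_congr_ae (.of_forall fun z => ?_)
    simp only [w, Pi.sub_apply, Pi.smul_apply, smul_eq_mul]
    ring
  · simp only [fderiv_eq_sum _ (w θ _)]
    exact (PolyGrowth.sum _ fun p _ => (Pw θ p).mul (PD p)).1.aestronglyMeasurable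
  · refine .of_forall fun z θ _ => (hbd _ _).trans (Finset.sum_le_sum fun p _ => ?_)
    refine (abs_sub _ _).trans (add_le_add ?_ ?_)
    · simp only [Pi.smul_apply, smul_eq_mul, abs_mul]
      exact mul_le_of_le_one_left (abs_nonneg _) (Real.abs_cos_le_one θ)
    · simp only [Pi.smul_apply, smul_eq_mul, abs_mul]
      exact mul_le_of_le_one_left (abs_nonneg _) (Real.abs_sin_le_one θ)
  · exact integrable_finsetSum _ fun p _ =>
      ((PW p).integrable _).abs.add ((PG p).integrable _).abs
  · refine .of_forall fun z θ _ => ?_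
    have h1 : HasDerivAt (fun θ => interp (Real.sin θ) (Real.cos θ) z) (w θ z) θ := by
      have := ((Real.hasDerivAt_sin θ).smul_const (wishartMap n d z.1)).add
        ((Real.hasDerivAt_cos θ).smul_const z.2)
      refine this.congr_deriv ?_
      simp [w, sub_eq_add_neg]
    exact (hdiff _).hasFDerivAt.comp_hasDerivAt θ h1

theorem abs_integral_wishartMap_sub_integral_le (hs0 : s 0 = 1) (hd : 1 ≤ d) (hv : 0 < v)
    (hμ : IsCenteredGaussianWithCov μ (rowCov n d s))
    (hν : IsCenteredGaussianWithCov ν (goeCov n v)) (hC : ContDiff ℝ 2 h)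
    (hL : ∀ x v, |fderiv ℝ h x v| ≤ √(∑ p, v p ^ 2))
    (hH : ∀ x, ‖fderiv ℝ (fderiv ℝ h) x‖ ≤ K) :
    |∫ x, h (wishartMap n d x) ∂μ - ∫ y, h y ∂ν| ≤
      1 / v * √(∫ z, ∑ p, stein v s z p ^ 2 ∂(μ.prod ν)) * (Real.pi / 2) := by
  have := hμ.gaussian
  have := hν.gaussian
  have hder := hasDerivAt_integral_interp (μ := μ) (ν := ν) hC hL
  have hbound : ∀ θ ∈ Set.Icc 0 (Real.pi / 2),
      ‖(Real.cos θ * ∑ p, ∫ z, wishartMap n d z.1 p *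
          fderiv ℝ h (interp (Real.sin θ) (Real.cos θ) z) (Pi.single p 1) ∂(μ.prod ν) -
        Real.sin θ * ∑ p, ∫ z, z.2 p *
          fderiv ℝ h (interp (Real.sin θ) (Real.cos θ) z) (Pi.single p 1) ∂(μ.prod ν))‖ ≤
      1 / v * √(∫ z, ∑ p, stein v s z p ^ 2 ∂(μ.prod ν)) := by
    intro θ _
    have PD := fun p => polyGrowth_fderiv_interp (d := d) hC hL (Real.sin θ) (Real.cos θ)
      (Pi.single p 1)
    have Psq : PolyGrowth (fun z : (Fin n × Fin d → ℝ) × (Fin n × Fin n → ℝ) =>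
        ∑ p, stein v s z p ^ 2) := by
      simp only [sq]
      exact .sum _ fun p _ => (polyGrowth_stein p).mul (polyGrowth_stein p)
    have h0 : ∀ z : (Fin n × Fin d → ℝ) × (Fin n × Fin n → ℝ), 0 ≤ ∑ p, stein v s z p ^ 2 :=
      fun z => Finset.sum_nonneg fun p _ => sq_nonneg _
    rw [sum_integral_eq_sum_integral_stein hs0 hd hv hμ hν hC hL hH,
      ← integral_finsetSum _ fun p _ => ((polyGrowth_stein p).mul (PD p)).integrable _,
      norm_mul, Real.norm_eq_abs, abs_div, abs_of_pos hv]
    have h1 : ‖∫ z, ∑ p, stein v s z p * fderiv ℝ h (interp (Real.sin θ) (Real.cos θ) z)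
        (Pi.single p 1) ∂(μ.prod ν)‖ ≤ √(∫ z, ∑ p, stein v s z p ^ 2 ∂(μ.prod ν)) := by
      simp only [← fderiv_eq_sum]
      refine le_trans (norm_integral_le_of_norm_le ?_ (.of_forall fun z => hL _ _))
        (integral_sqrt_le_sqrt_integral _ (Psq.integrable _) h0)
      -- Domination through `√t ≤ 1 + t` for `t ≥ 0`.
      refine Integrable.mono' (g := fun z => 1 + ∑ p, stein v s z p ^ 2)
        ((integrable_const _).add (Psq.integrable _))
        (Real.continuous_sqrt.comp Psq.1).aestronglyMeasurable (.of_forall fun z => ?_)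
      rw [Real.norm_of_nonneg (Real.sqrt_nonneg _), Real.sqrt_le_iff]
      constructor <;> nlinarith [h0 z]
    gcongr
    exact Real.abs_sin_le_one θ
  -- The angle `0` gives `G` and `π / 2` gives `W`; the derivative bound is uniform in the angle.
  have hmv := norm_image_sub_le_of_norm_deriv_le_segment' (a := 0) (b := Real.pi / 2)
    (fun θ _ => (hder θ).hasDerivWithinAt) (fun θ hθ => hbound θ (Set.Ico_subset_Icc_self hθ))
    (Real.pi / 2) (Set.right_mem_Icc.2 (by positivity))
  simp only [Real.sin_pi_div_two, Real.cos_pi_div_two, Real.sin_zero, Real.cos_zero, interp,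
    one_smul, zero_smul, add_zero, zero_add, sub_zero, Real.norm_eq_abs] at hmv
  have e1 := integral_fun_fst (μ := μ) (ν := ν) (fun x => h (wishartMap n d x))
  have e2 := integral_fun_snd (μ := μ) (ν := ν) h
  rw [e1, e2] at hmv
  simpa using hmv

end Interpolation

/-! ### Second moments of `d⁻¹ X S Xᵀ` -/

variable {n d : ℕ} {s : ℤ → ℝ} {μ : Measure (Fin n × Fin d → ℝ)}
  {ν : Measure (Fin n × Fin n → ℝ)} {v : ℝ}

/-- The average of `s (k - r) ^ 2` over `k` in `Fin d`, summed over `r`. -/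
noncomputable def avgSq (d : ℕ) (s : ℤ → ℝ) : ℝ :=
  (d : ℝ)⁻¹ * ∑ k : Fin d, ∑ r : Fin d, s ((k : ℤ) - r) ^ 2

theorem integral_weightedGram (hμ : IsCenteredGaussianWithCov μ (rowCov n d s)) (j l : Fin n) :
    ∫ x, weightedGram s x j l ∂μ = avgSq d s * if j = l then 1 else 0 := by
  have := hμ.gaussian
  have P : ∀ k r : Fin d, PolyGrowth (fun x : Fin n × Fin d → ℝ =>
      s ((k : ℤ) - r) * (x (j, k) * x (l, r))) :=
    fun k r => ((polyGrowth_eval _).mul (polyGrowth_eval _)).const_mul _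
  simp only [weightedGram, integral_const_mul]
  rw [integral_finsetSum _ fun k _ => (PolyGrowth.sum _ fun r _ => P k r).integrable _]
  simp only [fun k => integral_finsetSum (μ := μ) Finset.univ
    (fun r _ => (P k r).integrable μ), integral_const_mul, hμ.second, rowCov, avgSq]
  by_cases h : j = l <;> simp [h, sq]

/-- The three terms are the three Isserlis pairings. The first is the squared mean; the third pairs
row `j` with row `l` and survives only on the diagonal. -/
theorem integral_weightedGram_sq (hμ : IsCenteredGaussianWithCov μ (rowCov n d s)) (j l : Fin n) :
    ∫ x, weightedGram s x j l ^ 2 ∂μ = (avgSq d s) ^ 2 * (if j = l then 1 else 0) +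
      (d : ℝ)⁻¹ ^ 2 * ∑ k : Fin d, ∑ r : Fin d, ∑ k' : Fin d, ∑ r' : Fin d,
        s ((k : ℤ) - r) * s ((k' : ℤ) - r') * (s ((k : ℤ) - k') * s ((r : ℤ) - r')) +
      (d : ℝ)⁻¹ ^ 2 * (if j = l then 1 else 0) *
        ∑ k : Fin d, ∑ r : Fin d, ∑ k' : Fin d, ∑ r' : Fin d,
        s ((k : ℤ) - r) * s ((k' : ℤ) - r') * (s ((k : ℤ) - r') * s ((r : ℤ) - k')) := by
  have := hμ.gaussian
  have hsq : ∀ x : Fin n × Fin d → ℝ, weightedGram s x j l ^ 2 = (d : ℝ)⁻¹ ^ 2 *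
      ∑ k : Fin d, ∑ r : Fin d, ∑ k' : Fin d, ∑ r' : Fin d,
        s ((k : ℤ) - r) * s ((k' : ℤ) - r') * (x (j, k) * (x (l, r) * x (j, k') * x (l, r'))) := by
    intro x
    rw [weightedGram, mul_pow]
    congr 1
    rw [sq, Finset.sum_mul]
    refine Finset.sum_congr rfl fun k _ => ?_
    rw [Finset.sum_mul]
    refine Finset.sum_congr rfl fun r _ => ?_
    rw [Finset.mul_sum]
    refine Finset.sum_congr rfl fun k' _ => ?_
    rw [Finset.mul_sum]
    refine Finset.sum_congr rfl fun r' _ => ?_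
    ring
  have P : ∀ k r k' r' : Fin d, PolyGrowth (fun x : Fin n × Fin d → ℝ =>
      s ((k : ℤ) - r) * s ((k' : ℤ) - r') * (x (j, k) * (x (l, r) * x (j, k') * x (l, r')))) :=
    fun k r k' r' => ((polyGrowth_eval _).mul (((polyGrowth_eval _).mul (polyGrowth_eval _)).mul
      (polyGrowth_eval _))).const_mul _
  simp only [hsq, integral_const_mul]
  rw [integral_finsetSum _ fun k _ => (PolyGrowth.sum _ fun r _ => .sum _ fun k' _ =>
    .sum _ fun r' _ => P k r k' r').integrable _]
  simp only [fun k => integral_finsetSum (μ := μ) Finset.univ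
      (fun r _ => (PolyGrowth.sum Finset.univ fun k' _ => .sum Finset.univ fun r' _ =>
        P k r k' r').integrable μ),
    fun k r => integral_finsetSum (μ := μ) Finset.univ
      (fun k' _ => (PolyGrowth.sum Finset.univ fun r' _ => P k r k' r').integrable μ),
    fun k r k' => integral_finsetSum (μ := μ) Finset.univ
      (fun r' _ => (P k r k' r').integrable μ),
    integral_const_mul, hμ.integral_mul_mul_mul, rowCov, avgSq]
  rw [mul_pow, mul_assoc, mul_assoc _ (if j = l then (1 : ℝ) else 0), ← mul_add, ← mul_add]
  congr 1
  have e : (∑ k : Fin d, ∑ r : Fin d, s ((k : ℤ) - r) ^ 2) ^ 2 =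
      ∑ k : Fin d, ∑ r : Fin d, ∑ k' : Fin d, ∑ r' : Fin d,
        s ((k : ℤ) - r) * s ((k' : ℤ) - r') * (s ((k : ℤ) - r) * s ((k' : ℤ) - r')) := by
    rw [sq, Finset.sum_mul]
    refine Finset.sum_congr rfl fun k _ => ?_
    rw [Finset.sum_mul]
    refine Finset.sum_congr rfl fun r _ => ?_
    rw [Finset.mul_sum]
    refine Finset.sum_congr rfl fun k' _ => ?_
    rw [Finset.mul_sum]
    refine Finset.sum_congr rfl fun r' _ => ?_
    ring
  rw [e]
  by_cases h : j = l
  · simp only [h, if_true, mul_one, one_mul, ← Finset.sum_add_distrib]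
    refine Finset.sum_congr rfl fun k _ => Finset.sum_congr rfl fun r _ =>
      Finset.sum_congr rfl fun k' _ => Finset.sum_congr rfl fun r' _ => ?_
    ring
  · simp [h, Ne.symm h]

/-- The four factors form a cycle through `k, r, r', k'`. With absolute values, fixing the opposite
corners `k` and `r'` leaves the square of the sum over two-step paths between them. -/
theorem sum_cycle_le (s : ℤ → ℝ) (d : ℕ) :
    ∑ k : Fin d, ∑ r : Fin d, ∑ k' : Fin d, ∑ r' : Fin d,
      s ((k : ℤ) - r) * s ((k' : ℤ) - r') * (s ((k : ℤ) - k') * s ((r : ℤ) - r')) ≤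
      ∑ k : Fin d, ∑ t : Fin d, (∑ q : Fin d, |s ((k : ℤ) - q)| * |s ((q : ℤ) - t)|) ^ 2 := by
  refine Finset.sum_le_sum fun k _ => ?_
  have e : ∀ t : Fin d, (∑ q : Fin d, |s ((k : ℤ) - q)| * |s ((q : ℤ) - t)|) ^ 2 =
      ∑ r : Fin d, ∑ k' : Fin d, |s ((k : ℤ) - r)| * |s ((r : ℤ) - t)| *
        (|s ((k : ℤ) - k')| * |s ((k' : ℤ) - t)|) := fun t => by
    rw [sq, Finset.sum_mul_sum]
  have e' : ∑ t : Fin d, (∑ q : Fin d, |s ((k : ℤ) - q)| * |s ((q : ℤ) - t)|) ^ 2 =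
      ∑ r : Fin d, ∑ k' : Fin d, ∑ t : Fin d, |s ((k : ℤ) - r)| * |s ((r : ℤ) - t)| *
        (|s ((k : ℤ) - k')| * |s ((k' : ℤ) - t)|) := by
    simp only [e]
    rw [Finset.sum_comm]
    exact Finset.sum_congr rfl fun r _ => Finset.sum_comm
  rw [e']
  refine Finset.sum_le_sum fun r _ => Finset.sum_le_sum fun k' _ =>
    Finset.sum_le_sum fun r' _ => ?_
  refine (le_abs_self _).trans (le_of_eq ?_)
  simp only [abs_mul]
  ring

theorem sum_cycle_swap_le (hs : ∀ k, s (-k) = s k) (d : ℕ) :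
    ∑ k : Fin d, ∑ r : Fin d, ∑ k' : Fin d, ∑ r' : Fin d,
      s ((k : ℤ) - r) * s ((k' : ℤ) - r') * (s ((k : ℤ) - r') * s ((r : ℤ) - k')) ≤
      ∑ k : Fin d, ∑ t : Fin d, (∑ q : Fin d, |s ((k : ℤ) - q)| * |s ((q : ℤ) - t)|) ^ 2 := by
  refine le_trans (le_of_eq ?_) (sum_cycle_le s d)
  refine Finset.sum_congr rfl fun k _ => Finset.sum_congr rfl fun r _ => ?_
  rw [Finset.sum_comm]
  refine Finset.sum_congr rfl fun r' _ => Finset.sum_congr rfl fun k' _ => ?_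
  rw [← hs ((k' : ℤ) - r'), neg_sub]

theorem sum_integral_weightedGram_sub_sq_le (hs : ∀ k, s (-k) = s k)
    (hμ : IsCenteredGaussianWithCov μ (rowCov n d s)) :
    ∑ j, ∑ l, ∫ x, (weightedGram s x j l - avgSq d s * if j = l then 1 else 0) ^ 2 ∂μ ≤
      ((n : ℝ) ^ 2 + n) * ((d : ℝ)⁻¹ ^ 2 *
        (d * (∑ k ∈ Finset.Icc (-(d : ℤ)) d, |s k| ^ ((4 : ℝ) / 3)) ^ 3)) := by
  have := hμ.gaussian
  set Q := (d : ℝ) * (∑ k ∈ Finset.Icc (-(d : ℤ)) d, |s k| ^ ((4 : ℝ) / 3)) ^ 3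
  have hle : ∀ j l, ∫ x, (weightedGram s x j l - avgSq d s * if j = l then 1 else 0) ^ 2 ∂μ ≤
      (d : ℝ)⁻¹ ^ 2 * Q + (if j = l then 1 else 0) * ((d : ℝ)⁻¹ ^ 2 * Q) := by
    intro j l
    have PM := polyGrowth_weightedGram (d := d) s j l
    have hx : ∀ x : Fin n × Fin d → ℝ,
        (weightedGram s x j l - avgSq d s * if j = l then 1 else 0) ^ 2 =
        weightedGram s x j l ^ 2 - 2 * (avgSq d s * if j = l then 1 else 0) * weightedGram s x j l
          + avgSq d s ^ 2 * (if j = l then 1 else 0) := fun x => by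
      split_ifs <;> ring
    have P2 : PolyGrowth (fun x : Fin n × Fin d → ℝ => weightedGram s x j l ^ 2) := by
      simpa only [sq] using PM.mul PM
    simp only [hx]
    rw [integral_add ((P2.sub (PM.const_mul _)).integrable _) (integrable_const _),
      integral_sub (P2.integrable _) ((PM.const_mul _).integrable _), integral_const_mul,
      integral_weightedGram hμ, integral_weightedGram_sq hμ, integral_const]
    have h1 := mul_le_mul_of_nonneg_left ((sum_cycle_le s d).trans (sum_sq_sum_toeplitz_le d s))
      (by positivity : (0 : ℝ) ≤ (d : ℝ)⁻¹ ^ 2)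
    have h2 := mul_le_mul_of_nonneg_left
      ((sum_cycle_swap_le hs d).trans (sum_sq_sum_toeplitz_le d s))
      (by positivity : (0 : ℝ) ≤ (d : ℝ)⁻¹ ^ 2)
    split_ifs
    · simp
      simp at h1 h2
      linarith
    · simp
      simpa using h1
  calc _ ≤ ∑ j : Fin n, ∑ l : Fin n,
        ((d : ℝ)⁻¹ ^ 2 * Q + (if j = l then 1 else 0) * ((d : ℝ)⁻¹ ^ 2 * Q)) :=
        Finset.sum_le_sum fun j _ => Finset.sum_le_sum fun l _ => hle j l
    _ = _ := by
        simp only [Finset.sum_add_distrib, ite_mul, one_mul, zero_mul, Finset.sum_ite_eq,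
          Finset.mem_univ, if_true, Finset.sum_const, Finset.card_univ, Fintype.card_fin,
          nsmul_eq_mul]
        ring

/-- By independence, only the covariances within row `i` of `G` matter: `v` for each entry, plus an
extra `v` for the diagonal entry. After summation over `i` these contribute `v n` and `v`. -/
theorem integral_sum_stein_sq [IsGaussian μ] (hν : IsCenteredGaussianWithCov ν (goeCov n v)) :
    ∫ z, ∑ p, stein v s z p ^ 2 ∂(μ.prod ν) = v * (n + 1) *
      ∑ j, ∑ l, ∫ x, (weightedGram s x j l - v * if j = l then 1 else 0) ^ 2 ∂μ := by
  have := hν.gaussian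
  set M : Fin n → Fin n → (Fin n × Fin d → ℝ) → ℝ :=
    fun j l x => weightedGram s x j l - v * if j = l then 1 else 0 with hM
  have PM : ∀ j l, PolyGrowth (M j l) := fun j l => (polyGrowth_weightedGram s j l).sub (.const _)
  have PS : ∀ p, PolyGrowth (fun z : (Fin n × Fin d → ℝ) × (Fin n × Fin n → ℝ) =>
      stein v s z p ^ 2) := fun p => by
    simpa only [sq] using (polyGrowth_stein p).mul (polyGrowth_stein p)
  have hp : ∀ p : Fin n × Fin n, ∫ z, stein v s z p ^ 2 ∂(μ.prod ν) =
      v * ∑ l, ∫ x, M p.2 l x ^ 2 ∂μ + v * ∫ x, M p.2 p.1 x ^ 2 ∂μ := by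
    rintro ⟨i, j⟩
    have hexp : ∀ z : (Fin n × Fin d → ℝ) × (Fin n × Fin n → ℝ), stein v s z (i, j) ^ 2 =
        ∑ l, ∑ l', (M j l z.1 * M j l' z.1) * (z.2 (i, l) * z.2 (i, l')) := fun z => by
      rw [stein, sq, Finset.sum_mul_sum]
      refine Finset.sum_congr rfl fun l _ => Finset.sum_congr rfl fun l' _ => ?_
      simp only [hM]
      ring
    have P : ∀ l l', PolyGrowth (fun z : (Fin n × Fin d → ℝ) × (Fin n × Fin n → ℝ) =>
        (M j l z.1 * M j l' z.1) * (z.2 (i, l) * z.2 (i, l'))) := fun l l' =>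
      ((PM j l).comp_fst.mul (PM j l').comp_fst).mul
        ((polyGrowth_eval _).comp_snd.mul (polyGrowth_eval _).comp_snd)
    simp only [hexp]
    rw [integral_finsetSum _ fun l _ => (PolyGrowth.sum _ fun l' _ => P l l').integrable _]
    simp only [fun l => integral_finsetSum (μ := μ.prod ν) Finset.univ
      (fun l' _ => (P l l').integrable _)]
    have hprod : ∀ l l', ∫ z : (Fin n × Fin d → ℝ) × (Fin n × Fin n → ℝ),
        (M j l z.1 * M j l' z.1) * (z.2 (i, l) * z.2 (i, l')) ∂(μ.prod ν) =
        (∫ x, M j l x * M j l' x ∂μ) * goeCov n v (i, l) (i, l') := fun l l' => by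
      rw [integral_prod_mul (fun x => M j l x * M j l' x)
        (fun y : Fin n × Fin n → ℝ => y (i, l) * y (i, l')), hν.second]
    have hg : ∀ l l', goeCov n v (i, l) (i, l') =
        (if l = l' then v else 0) + if l = i then (if i = l' then v else 0) else 0 := fun l l' => by
      simp only [goeCov, Prod.mk.injEq, Prod.swap_prod_mk]
      by_cases h1 : l = l' <;> by_cases h2 : l = i <;> by_cases h3 : i = l' <;> simp_all; ring
    simp only [hprod, hg, mul_add, Finset.sum_add_distrib, mul_ite, mul_zero, Finset.sum_ite_eq,
      Finset.mem_univ, if_true]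
    congr 1
    · rw [Finset.mul_sum]
      exact Finset.sum_congr rfl fun l _ => by simp only [sq]; ring
    · rw [Finset.sum_comm]
      simp only [Finset.sum_ite_eq', Finset.sum_ite_eq, Finset.mem_univ, if_true, sq]
      ring
  rw [integral_finsetSum _ fun p _ => (PS p).integrable _]
  simp only [hp, Fintype.sum_prod_type, Finset.sum_add_distrib, ← Finset.mul_sum,
    Finset.sum_const, Finset.card_univ, Fintype.card_fin, nsmul_eq_mul]
  rw [Finset.sum_comm (f := fun i j => ∫ x, M j i x ^ 2 ∂μ)]
  ring

end WishartGaussian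

/-! ### Identification of Gaussian laws by their covariance -/

theorem ProbabilityTheory.HasGaussianLaw.isCenteredGaussianWithCov {Ω ι : Type*}
    [MeasurableSpace Ω] {P : Measure Ω} [Fintype ι] {Y : Ω → ι → ℝ} {S : ι → ι → ℝ}
    (hY : HasGaussianLaw Y P) (hm : ∀ p, ∫ ω, Y ω p ∂P = 0)
    (hs : ∀ p q, ∫ ω, Y ω p * Y ω q ∂P = S p q) : IsCenteredGaussianWithCov (P.map Y) S where
  gaussian := hY.isGaussian_map
  mean p := by
    rw [integral_map hY.aemeasurable (measurable_pi_apply p).aestronglyMeasurable, hm]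
  second p q := by
    rw [integral_map hY.aemeasurable (by fun_prop), hs]

namespace IsCenteredGaussianWithCov

variable {ι : Type*} [Fintype ι] {μ ν : Measure (ι → ℝ)} {S : ι → ι → ℝ}

theorem integral_dual (h : IsCenteredGaussianWithCov μ S) (L : StrongDual ℝ (ι → ℝ)) :
    ∫ x, L x ∂μ = 0 := by
  have := h.gaussian
  obtain ⟨a, ha⟩ := L.exists_apply_eq_sum
  simp only [ha]
  rw [integral_finsetSum _ fun q _ => ((polyGrowth_eval q).const_mul _).integrable _]
  simp [integral_const_mul, h.mean]

theorem variance_dual (h : IsCenteredGaussianWithCov μ S) {L : StrongDual ℝ (ι → ℝ)} {a : ι → ℝ}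
    (ha : ∀ x, L x = ∑ q, a q * x q) : Var[L; μ] = ∑ q, a q * L (S q) := by
  have := h.gaussian
  have hm : ∀ q, MemLp (fun x : ι → ℝ => x q) 2 μ := fun q =>
    IsGaussian.memLp_dual μ (ContinuousLinearMap.proj q) 2 (by simp)
  have hL : (L : (ι → ℝ) → ℝ) = fun x => ∑ q, a q * x q := funext ha
  rw [← covariance_self (by fun_prop)]
  conv_lhs => rw [hL]
  rw [covariance_fun_sum_left (fun q => (hm q).const_mul _)
    (by rw [← hL]; exact IsGaussian.memLp_dual μ L 2 (by simp))]
  refine Finset.sum_congr rfl fun q _ => ?_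
  rw [covariance_const_mul_left, ← hL]
  exact congrArg _ (h.covariance_eval q L)

theorem ext (hμ : IsCenteredGaussianWithCov μ S) (hν : IsCenteredGaussianWithCov ν S) :
    μ = ν := by
  have := hμ.gaussian
  have := hν.gaussian
  refine Measure.ext_of_charFunDual ?_
  ext L
  obtain ⟨a, ha⟩ := L.exists_apply_eq_sum
  rw [IsGaussian.charFunDual_eq, IsGaussian.charFunDual_eq, hμ.variance_dual ha,
    hν.variance_dual ha, integral_complex_ofReal, integral_complex_ofReal, hμ.integral_dual,
    hν.integral_dual]

end IsCenteredGaussianWithCov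

/-! ### Transfer to matrices with the Hilbert–Schmidt norm -/

namespace WishartGaussian

open IsCenteredGaussianWithCov (polyGrowth_eval)

theorem norm_of_eq_sqrt {n : ℕ} (y : Fin n × Fin n → ℝ) :
    ‖(Matrix.of fun i j => y (i, j) : Matrix (Fin n) (Fin n) ℝ)‖ = √(∑ p, y p ^ 2) := by
  rw [Matrix.frobenius_norm_def, Real.sqrt_eq_rpow, Fintype.sum_prod_type]
  simp

theorem abs_sub_le_of_lipschitz {n : ℕ} {g : Matrix (Fin n) (Fin n) ℝ → ℝ}
    (hg : LipschitzWith 1 g) (x y : Fin n × Fin n → ℝ) :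
    |g (Matrix.of fun i j => x (i, j)) - g (Matrix.of fun i j => y (i, j))| ≤
      √(∑ p, (x p - y p) ^ 2) := by
  have h1 := hg.dist_le_mul (Matrix.of fun i j => x (i, j)) (Matrix.of fun i j => y (i, j))
  rw [NNReal.coe_one, one_mul, Real.dist_eq, dist_eq_norm] at h1
  exact h1.trans (le_of_eq (norm_of_eq_sqrt (fun p => x p - y p)))

/-- The norm on `Fin n × Fin n → ℝ` is the sup norm, so mollification is done on `EuclideanSpace`,
where the gradient bound is the Hilbert–Schmidt one. The Hessian bound is carried back with a loss,
which is harmless. -/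
theorem exists_smooth_approx {n : ℕ} {g : Matrix (Fin n) (Fin n) ℝ → ℝ} (hg : LipschitzWith 1 g)
    {ε : ℝ} (hε : 0 < ε) :
    ∃ (h : (Fin n × Fin n → ℝ) → ℝ) (K : ℝ), ContDiff ℝ 2 h ∧
      (∀ x v, |fderiv ℝ h x v| ≤ √(∑ p, v p ^ 2)) ∧ (∀ x, ‖fderiv ℝ (fderiv ℝ h) x‖ ≤ K) ∧
      ∀ x, |h x - g (Matrix.of fun i j => x (i, j))| ≤ ε := by
  let T : (Fin n × Fin n → ℝ) ≃L[ℝ] EuclideanSpace ℝ (Fin n × Fin n) :=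
    (EuclideanSpace.equiv (Fin n × Fin n) ℝ).symm
  have hT : ∀ v, ‖T v‖ = √(∑ p, v p ^ 2) := fun v => by
    rw [EuclideanSpace.norm_eq]
    simp [T]
  have hg0 : LipschitzWith 1 (fun x => g (Matrix.of fun i j => T.symm x (i, j))) := by
    refine LipschitzWith.of_dist_le_mul fun x y => ?_
    rw [Real.dist_eq, NNReal.coe_one, one_mul, dist_eq_norm]
    refine (abs_sub_le_of_lipschitz hg (T.symm x) (T.symm y)).trans (le_of_eq ?_)
    rw [← T.apply_symm_apply (x - y), hT]
    simp
  obtain ⟨h, hC, hL, ⟨K, hK⟩, happ⟩ := hg0.exists_contDiff_two_approx hε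
  have hdiff := hC.differentiable (by norm_num)
  have hd : ∀ x, fderiv ℝ (fun x => h (T x)) x =
      (fderiv ℝ h (T x)).comp (T : (Fin n × Fin n → ℝ) →L[ℝ] _) := fun x => by
    exact ((hdiff (T x)).hasFDerivAt.comp x T.hasFDerivAt).fderiv
  have hK0 : 0 ≤ K := (norm_nonneg (fderiv ℝ (fderiv ℝ h) 0)).trans (hK 0)
  have hlip : LipschitzWith K.toNNReal (fderiv ℝ h) :=
    lipschitzWith_of_nnnorm_fderiv_le
      ((hC.fderiv_right (m := 1) (by norm_num)).differentiable (by norm_num)) fun x => by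
        rw [← NNReal.coe_le_coe, Real.coe_toNNReal _ hK0]
        exact hK x
  let N := ‖(T : (Fin n × Fin n → ℝ) →L[ℝ] EuclideanSpace ℝ (Fin n × Fin n))‖
  have hlip' : LipschitzWith (K * N * N).toNNReal (fderiv ℝ fun x => h (T x)) := by
    refine LipschitzWith.of_dist_le_mul fun x y => ?_
    rw [dist_eq_norm, hd, hd, ← ContinuousLinearMap.sub_comp,
      Real.coe_toNNReal _ (by positivity)]
    refine (ContinuousLinearMap.opNorm_comp_le _ _).trans ?_
    have h1 := hlip.dist_le_mul (T x) (T y)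
    rw [dist_eq_norm, dist_eq_norm, Real.coe_toNNReal _ hK0, ← map_sub] at h1
    have h2 : ‖T (x - y)‖ ≤ N * dist x y := by
      rw [dist_eq_norm]
      exact ContinuousLinearMap.le_opNorm
        (T : (Fin n × Fin n → ℝ) →L[ℝ] EuclideanSpace ℝ (Fin n × Fin n)) (x - y)
    calc _ ≤ (K * (N * dist x y)) * N := by
          gcongr
          exact h1.trans (by gcongr)
      _ = _ := by ring
  refine ⟨fun x => h (T x), (K * N * N).toNNReal, hC.comp T.contDiff, fun x v => ?_,
    fun x => norm_fderiv_le_of_lipschitz ℝ hlip', fun x => by simpa using happ (T x)⟩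
  rw [hd, ← hT, ContinuousLinearMap.comp_apply, ← Real.norm_eq_abs]
  refine (ContinuousLinearMap.le_opNorm _ _).trans ?_
  have := norm_fderiv_le_of_lipschitz ℝ hL (x₀ := T x)
  rw [NNReal.coe_one] at this
  exact mul_le_of_le_one_left (norm_nonneg _) this

theorem integrable_comp_of_lipschitz {n : ℕ} {Ω : Type*} [MeasurableSpace Ω] {P : Measure Ω}
    [IsProbabilityMeasure P] {g : Matrix (Fin n) (Fin n) ℝ → ℝ} (hg : LipschitzWith 1 g)
    {f : (Fin n × Fin n → ℝ) → ℝ} (hf : Continuous f) {ε : ℝ}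
    (hfg : ∀ x, |f x - g (Matrix.of fun i j => x (i, j))| ≤ ε) {Y : Ω → Fin n × Fin n → ℝ}
    (hY : ∀ p, Integrable (fun ω => Y ω p) P) : Integrable (fun ω => f (Y ω)) P := by
  have hm : AEMeasurable Y P := aemeasurable_pi_lambda _ fun p => (hY p).1.aemeasurable
  refine Integrable.mono' (g := fun ω => ε + |g 0| + ∑ p, |Y ω p|)
    ((integrable_const _).add (integrable_finsetSum _ fun p _ => (hY p).abs))
    (hf.comp_aestronglyMeasurable hm.aestronglyMeasurable) (.of_forall fun ω => ?_)
  have h1 := hfg (Y ω)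
  have h2 := abs_sub_le_of_lipschitz hg (Y ω) 0
  have h3 : √(∑ p, (Y ω p - (0 : Fin n × Fin n → ℝ) p) ^ 2) ≤ ∑ p, |Y ω p| := by
    refine Real.sqrt_le_iff.2 ⟨Finset.sum_nonneg fun p _ => abs_nonneg _, ?_⟩
    simpa using Finset.sum_sq_le_sq_sum_of_nonneg (s := Finset.univ) (f := fun p => |Y ω p|)
      fun p _ => abs_nonneg _
  have h4 : (Matrix.of fun i j => (0 : Fin n × Fin n → ℝ) (i, j)) =
    (0 : Matrix (Fin n) (Fin n) ℝ) := rfl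
  rw [h4] at h2
  rw [Real.norm_eq_abs]
  have h5 := abs_sub_abs_le_abs_sub (f (Y ω)) (g (Matrix.of fun i j => Y ω (i, j)))
  have h6 := abs_sub_abs_le_abs_sub (g (Matrix.of fun i j => Y ω (i, j))) (g 0)
  linarith

theorem continuous_comp_of {n : ℕ} {g : Matrix (Fin n) (Fin n) ℝ → ℝ} (hg : LipschitzWith 1 g) :
    Continuous (fun x : Fin n × Fin n → ℝ => g (Matrix.of fun i j => x (i, j))) := by
  refine hg.continuous.comp ?_
  exact continuous_matrix fun i j => continuous_apply (i, j)

variable {n d : ℕ} {s : ℤ → ℝ} {μ : Measure (Fin n × Fin d → ℝ)}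

/-- In Isserlis' formula the pairing within each product is removed by the means. The other two give
`s (k - r) ^ 2` on `p = q` and on `p.swap = q`. -/
theorem covariance_wishartMap (hμ : IsCenteredGaussianWithCov μ (rowCov n d s))
    (p q : Fin n × Fin n) :
    cov[fun x => wishartMap n d x p, fun x => wishartMap n d x q; μ] =
      goeCov n (avgSq d s) p q := by
  have := hμ.gaussian
  have P : ∀ (p : Fin n × Fin n) k,
      PolyGrowth (fun x : Fin n × Fin d → ℝ => x (p.1, k) * x (p.2, k)) :=
    fun p k => (polyGrowth_eval _).mul (polyGrowth_eval _)
  have hL : ∀ (p : Fin n × Fin n) k,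
      MemLp (fun x : Fin n × Fin d → ℝ => x (p.1, k) * x (p.2, k)) 2 μ := fun p k => by
    rw [memLp_two_iff_integrable_sq (P p k).1.aestronglyMeasurable]
    simpa only [sq] using ((P p k).mul (P p k)).integrable μ
  have hI : ∀ p : Fin n × Fin n, Integrable (fun x : Fin n × Fin d → ℝ =>
      (√(d : ℝ))⁻¹ * ∑ k, x (p.1, k) * x (p.2, k)) μ := fun p =>
    ((PolyGrowth.sum _ fun k _ => P p k).const_mul _).integrable _
  simp only [wishartMap]
  rw [covariance_sub_const_left (hI p), covariance_sub_const_right (hI q),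
    covariance_const_mul_left, covariance_const_mul_right,
    covariance_fun_sum_fun_sum (hL p) (hL q)]
  have hc : ∀ k r, cov[fun x : Fin n × Fin d → ℝ => x (p.1, k) * x (p.2, k),
      fun x => x (q.1, r) * x (q.2, r); μ] =
      s ((k : ℤ) - r) ^ 2 * ((if p = q then 1 else 0) + if p.swap = q then 1 else 0) := by
    intro k r
    rw [covariance_eq_sub (hL p k) (hL q r)]
    have h4 := hμ.integral_mul_mul_mul (p.1, k) (p.2, k) (q.1, r) (q.2, r)
    have e : ∀ x : Fin n × Fin d → ℝ, ((fun x : Fin n × Fin d → ℝ => x (p.1, k) * x (p.2, k)) *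
        fun x : Fin n × Fin d → ℝ => x (q.1, r) * x (q.2, r)) x =
        x (p.1, k) * (x (p.2, k) * x (q.1, r) * x (q.2, r)) := fun x => by
      simp only [Pi.mul_apply]; ring
    simp only [e]
    have hr : ∀ a b : Fin n × Fin d, rowCov n d s a b =
        (if a.1 = b.1 then 1 else 0) * s ((a.2 : ℤ) - b.2) := fun a b => by simp [rowCov]
    have hpq : (if p = q then (1 : ℝ) else 0) =
        (if p.1 = q.1 then 1 else 0) * if p.2 = q.2 then 1 else 0 := by
      simp only [Prod.ext_iff, ite_and, ite_mul, one_mul, zero_mul]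
    have hpq' : (if p.swap = q then (1 : ℝ) else 0) =
        (if p.2 = q.1 then 1 else 0) * if p.1 = q.2 then 1 else 0 := by
      simp only [Prod.ext_iff, Prod.fst_swap, Prod.snd_swap, ite_and, ite_mul, one_mul, zero_mul]
    rw [h4, hpq, hpq']
    simp only [hμ.second, hr]
    ring
  simp only [hc, ← Finset.sum_mul]
  rw [goeCov, avgSq, ← mul_assoc, ← mul_assoc, ← mul_inv, Real.mul_self_sqrt (by positivity)]

theorem avgSq_eq (hd : 1 ≤ d) (s : ℤ → ℝ) :
    avgSq d s = ∑ k ∈ Finset.Icc (-(d : ℤ)) d, (1 - |(k : ℝ)| / (d : ℝ)) * s k ^ 2 := by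
  have hd0 : (d : ℝ) ≠ 0 := by positivity
  rw [avgSq, sum_fin_sum_fin_sub d (fun k => s k ^ 2), Finset.mul_sum]
  refine Finset.sum_congr rfl fun k _ => ?_
  field_simp

theorem one_le_avgSq (hd : 1 ≤ d) (hs0 : s 0 = 1) : 1 ≤ avgSq d s := by
  have hd0 : (0 : ℝ) < d := by exact_mod_cast hd
  rw [avgSq_eq hd]
  -- The term `k = 0` is `s 0 ^ 2 = 1`, and all weights are nonnegative.
  refine le_trans (by simp [hs0]) (Finset.single_le_sum
    (f := fun k : ℤ => (1 - |(k : ℝ)| / (d : ℝ)) * s k ^ 2) (fun k hk => ?_)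
    (Finset.mem_Icc.2 ⟨by omega, by omega⟩ : (0 : ℤ) ∈ _))
  have h1 : |(k : ℝ)| ≤ d := by
    rw [abs_le]
    have := Finset.mem_Icc.1 hk
    exact ⟨by exact_mod_cast this.1, by exact_mod_cast this.2⟩
  have h2 : |(k : ℝ)| / (d : ℝ) ≤ 1 := (div_le_one hd0).2 h1
  exact mul_nonneg (by linarith) (sq_nonneg _)

end WishartGaussian

namespace WishartGaussian

open IsCenteredGaussianWithCov (polyGrowth_eval)

theorem wishart_eq_wishartMap {Ω : Type*} {n d : ℕ} {X : ℕ → ℕ → Ω → ℝ} (hd : 1 ≤ d) (ω : Ω) :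
    wishart X n d ω = Matrix.of fun i j =>
      wishartMap n d (fun p => X p.1 p.2 ω) (i, j) := by
  ext i j
  have hd0 : (0 : ℝ) < d := by exact_mod_cast hd
  have e : √(d : ℝ) * (d : ℝ)⁻¹ = (√(d : ℝ))⁻¹ := by
    rw [← div_eq_mul_inv, Real.sqrt_div_self', one_div]
  simp only [wishart, wishartMap, dataMatrix, Matrix.smul_apply, Matrix.sub_apply,
    Matrix.mul_apply, Matrix.transpose_apply, Matrix.of_apply, Matrix.one_apply, smul_eq_mul]
  rw [mul_sub, ← mul_assoc, e]

/-! ### Laws of the data matrix and of the Gaussian counterpart -/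

section Data

variable {Ω : Type*} [MeasurableSpace Ω] {P : Measure Ω} {s : ℤ → ℝ} {X : ℕ → ℕ → Ω → ℝ}

theorem IsRowIndepGaussianArray.neg_eq (hX : IsRowIndepGaussianArray s X P) (k : ℤ) :
    s (-k) = s k := by
  have h : ∀ m : ℕ, s (-(m : ℤ)) = s m := fun m => by
    have h1 := hX.covariance 0 0 0 m
    have h2 := hX.covariance 0 m 0 0
    simp only [mul_comm (X 0 m _), if_true] at h1 h2
    simpa using h1.symm.trans h2
  obtain ⟨m, rfl | rfl⟩ := k.eq_nat_or_neg
  · exact h m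
  · rw [neg_neg, h m]

theorem IsRowIndepGaussianArray.hasGaussianLaw (hX : IsRowIndepGaussianArray s X P) (n d : ℕ) :
    HasGaussianLaw (fun ω (p : Fin n × Fin d) => X p.1 p.2 ω) P := by
  have h := (hX.gaussian.comp_right
    (fun p : Fin n × Fin d => ((p.1 : ℕ), (p.2 : ℕ)))).hasGaussianLaw Finset.univ
  let U := (Finset.univ : Finset (Fin n × Fin d))
  exact h.map (ContinuousLinearMap.pi fun p =>
    (ContinuousLinearMap.proj (⟨p, Finset.mem_univ p⟩ : U) : (U → ℝ) →L[ℝ] ℝ))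

theorem IsRowIndepGaussianArray.isCenteredGaussianWithCov (hX : IsRowIndepGaussianArray s X P)
    (n d : ℕ) :
    IsCenteredGaussianWithCov (P.map fun ω (p : Fin n × Fin d) => X p.1 p.2 ω)
      (rowCov n d s) :=
  (hX.hasGaussianLaw n d).isCenteredGaussianWithCov (fun p => hX.centered _ _) fun p q => by
    simp [hX.covariance, rowCov, Fin.ext_iff]

variable {n d : ℕ} {Ω' : Type*} [MeasurableSpace Ω'] {P' : Measure Ω'}
  {G : Ω' → Matrix (Fin n) (Fin n) ℝ}

theorem IsGaussianCounterpart.isCenteredGaussianWithCov (hd : 1 ≤ d)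
    (hX : IsRowIndepGaussianArray s X P)
    (hG : IsGaussianCounterpart (wishart X n d) P G P') :
    IsCenteredGaussianWithCov (P'.map fun ω (p : Fin n × Fin n) => G ω p.1 p.2)
      (goeCov n (avgSq d s)) := by
  have := hG.gaussian.isProbabilityMeasure
  have hμ := hX.isCenteredGaussianWithCov n d
  have hae := (hX.hasGaussianLaw n d).aemeasurable
  have hm : ∀ p : Fin n × Fin n, MemLp (fun ω => G ω p.1 p.2) 2 P' := fun p =>
    (hG.gaussian.eval p).memLp_two
  refine hG.gaussian.isCenteredGaussianWithCov (fun p => hG.centered _ _) fun p q => ?_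
  have h1 := covariance_eq_sub (hm p) (hm q)
  rw [hG.centered, hG.centered, mul_zero, sub_zero, hG.covariance] at h1
  refine h1.symm.trans ?_
  have hw : ∀ p : Fin n × Fin n, AEStronglyMeasurable (fun x => wishartMap n d x p)
      (P.map fun ω (p : Fin n × Fin d) => X p.1 p.2 ω) := fun p =>
    ((continuous_apply p).comp (continuous_wishartMap n d)).aestronglyMeasurable
  rw [← covariance_wishartMap hμ p q, covariance_map_fun (hw p) (hw q) hae]
  simp only [wishart_eq_wishartMap hd, Matrix.of_apply]

end Data

/-! ### Distance from the Wishart matrix to its Gaussian counterpart -/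

theorem abs_integral_sub_le_of_lipschitz {n d : ℕ} {s : ℤ → ℝ} {μ : Measure (Fin n × Fin d → ℝ)}
    {ν : Measure (Fin n × Fin n → ℝ)} (hs0 : s 0 = 1) (hs : ∀ k, s (-k) = s k) (hn : 1 ≤ n)
    (hd : 1 ≤ d) (hμ : IsCenteredGaussianWithCov μ (rowCov n d s))
    (hν : IsCenteredGaussianWithCov ν (goeCov n (avgSq d s)))
    {g : Matrix (Fin n) (Fin n) ℝ → ℝ} (hg : LipschitzWith 1 g) :
    |∫ x, g (Matrix.of fun i j => wishartMap n d x (i, j)) ∂μ -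
      ∫ y, g (Matrix.of fun i j => y (i, j)) ∂ν| ≤
      √(192 * (n : ℝ) ^ 3 / avgSq d s * (1 / (d : ℝ) *
        (∑ k ∈ Finset.Icc (-(d : ℤ)) d, |s k| ^ ((4 : ℝ) / 3)) ^ 3)) := by
  have := hμ.gaussian
  have := hν.gaussian
  have hv1 := one_le_avgSq hd hs0
  have hv : 0 < avgSq d s := by linarith
  have hd0 : (0 : ℝ) < d := by exact_mod_cast hd
  have hn1 : (1 : ℝ) ≤ n := by exact_mod_cast hn
  set v := avgSq d s with hvd
  set A := (∑ k ∈ Finset.Icc (-(d : ℤ)) d, |s k| ^ ((4 : ℝ) / 3)) ^ 3 with hA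
  have hA0 : 0 ≤ A := by positivity
  have hconst : 1 / v * √(∫ z, ∑ p, stein v s z p ^ 2 ∂(μ.prod ν)) * (Real.pi / 2) ≤
      √(192 * (n : ℝ) ^ 3 / v * (1 / (d : ℝ) * A)) := by
    have h1 : ∫ z, ∑ p, stein v s z p ^ 2 ∂(μ.prod ν) ≤ v * (n + 1) *
        (((n : ℝ) ^ 2 + n) * ((d : ℝ)⁻¹ ^ 2 * (d * A))) := by
      rw [integral_sum_stein_sq hν]
      exact mul_le_mul_of_nonneg_left (sum_integral_weightedGram_sub_sq_le hs hμ) (by positivity)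
    refine Real.le_sqrt_of_sq_le ?_
    have h0 : 0 ≤ ∫ z, ∑ p, stein v s z p ^ 2 ∂(μ.prod ν) :=
      integral_nonneg fun z => Finset.sum_nonneg fun p _ => sq_nonneg _
    -- Crude constants suffice: `π² / 4 ≤ 4` and `n (n + 1)² ≤ 4 n³` give `16 n³`, well below `192
    -- n³`.
    have hpi : Real.pi ^ 2 ≤ 16 := by nlinarith [Real.pi_le_four, Real.pi_pos]
    have hn3 : (n + 1 : ℝ) * ((n : ℝ) ^ 2 + n) ≤ 4 * (n : ℝ) ^ 3 := by nlinarith [sq_nonneg (n : ℝ)]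
    rw [mul_pow, mul_pow, Real.sq_sqrt h0]
    calc (1 / v) ^ 2 * (∫ z, ∑ p, stein v s z p ^ 2 ∂(μ.prod ν)) * (Real.pi / 2) ^ 2
        ≤ (1 / v) ^ 2 * (v * (n + 1) * (((n : ℝ) ^ 2 + n) * ((d : ℝ)⁻¹ ^ 2 * (d * A)))) *
          (16 / 4) := by
          gcongr
          rw [div_pow]
          linarith
      _ = 4 * ((n + 1 : ℝ) * ((n : ℝ) ^ 2 + n)) / v * (1 / (d : ℝ) * A) := by
          field_simp
          ring
      _ ≤ 192 * (n : ℝ) ^ 3 / v * (1 / (d : ℝ) * A) := by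
          have h4 : 4 * ((n + 1 : ℝ) * ((n : ℝ) ^ 2 + n)) ≤ 192 * (n : ℝ) ^ 3 := by
            linarith [pow_pos (by linarith : (0 : ℝ) < n) 3]
          exact mul_le_mul_of_nonneg_right (div_le_div_of_nonneg_right h4 hv.le) (by positivity)
  refine le_of_forall_pos_le_add fun δ hδ => ?_
  obtain ⟨h, K, hC, hL, hH, happ⟩ := exists_smooth_approx hg (half_pos hδ)
  have hmain := (abs_integral_wishartMap_sub_integral_le hs0 hd hv hμ hν hC hL hH).trans hconst
  have iW : ∀ p, Integrable (fun x => wishartMap n d x p) μ := fun p =>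
    (polyGrowth_wishartMap p).integrable μ
  have iG : ∀ p, Integrable (fun y : Fin n × Fin n → ℝ => y p) ν := fun p =>
    (polyGrowth_eval p).integrable ν
  have i1 := integrable_comp_of_lipschitz hg hC.continuous happ iW
  have i2 := integrable_comp_of_lipschitz hg hC.continuous happ iG
  -- With `ε = 0` the function `g` is its own approximation.
  have i3 := integrable_comp_of_lipschitz hg (continuous_comp_of hg) (ε := 0) (by simp) iW
  have i4 := integrable_comp_of_lipschitz hg (continuous_comp_of hg) (ε := 0) (by simp) iG
  have b1 : |∫ x, h (wishartMap n d x) ∂μ -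
      ∫ x, g (Matrix.of fun i j => wishartMap n d x (i, j)) ∂μ| ≤ δ / 2 := by
    rw [← integral_sub i1 i3, ← Real.norm_eq_abs]
    simpa using norm_integral_le_of_norm_le_const (μ := μ)
      (f := fun x => h (wishartMap n d x) - g (Matrix.of fun i j => wishartMap n d x (i, j)))
      (.of_forall fun x => happ (wishartMap n d x))
  have b2 : |∫ y, h y ∂ν - ∫ y, g (Matrix.of fun i j => y (i, j)) ∂ν| ≤ δ / 2 := by
    rw [← integral_sub i2 i4, ← Real.norm_eq_abs]
    simpa using norm_integral_le_of_norm_le_const (μ := ν)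
      (f := fun y => h y - g (Matrix.of fun i j => y (i, j))) (.of_forall happ)
  rw [abs_le] at hmain b1 b2 ⊢
  constructor <;> linarith [hmain.1, hmain.2, b1.1, b1.2, b2.1, b2.2]

/-! ### Comparison with the matrix with independent entries -/

section GOE

variable {n : ℕ} {Ω : Type*} [MeasurableSpace Ω] {P : Measure Ω} {v : ℝ}
  {Z : Ω → Matrix (Fin n) (Fin n) ℝ}

/-- The position on or above the diagonal that carries the same entry of a symmetric matrix. -/
def sortPair (p : Fin n × Fin n) : {p : Fin n × Fin n // p.1 ≤ p.2} :=
  ⟨(min p.1 p.2, max p.1 p.2), min_le_max⟩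

theorem sortPair_eq_iff (p q : Fin n × Fin n) : sortPair p = sortPair q ↔ p = q ∨ p.swap = q := by
  obtain ⟨a, b⟩ := p
  obtain ⟨c, e⟩ := q
  simp only [sortPair, Subtype.mk.injEq, Prod.mk.injEq, Prod.swap_prod_mk]
  rcases le_total a b with h | h <;> rcases le_total c e with h' | h' <;>
    simp only [min_eq_left, min_eq_right, max_eq_left, max_eq_right, h, h'] <;> omega

/-- By symmetry the full matrix is almost surely a linear image, under `sortPair`, of its
independent upper triangle. Two positions share an entry exactly when they agree up to
transposition, which gives the two indicators of `goeCov`; on the diagonal both equal 1. -/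
theorem IsGOE.isCenteredGaussianWithCov [IsProbabilityMeasure P] (hv : 0 ≤ v)
    (hZ : IsGOE v Z P) :
    HasGaussianLaw (fun ω (p : Fin n × Fin n) => Z ω p.1 p.2) P ∧
    IsCenteredGaussianWithCov (P.map fun ω (p : Fin n × Fin n) => Z ω p.1 p.2)
      (goeCov n v) := by
  let Y : {p : Fin n × Fin n // p.1 ≤ p.2} → Ω → ℝ := fun p ω => Z ω p.1.1 p.1.2
  have hlaw : ∀ p, HasLaw (Y p)
      (gaussianReal 0 (v * (1 + if p.1.1 = p.1.2 then 1 else 0)).toNNReal) P := by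
    rintro ⟨⟨i, j⟩, hij⟩
    rcases (show i ≤ j from hij).eq_or_lt with rfl | hlt
    · have := hZ.diag i
      simp only [if_true]
      convert this using 3
      ring
    · simpa [hlt.ne] using hZ.offDiag i j hlt
  have hYG : HasGaussianLaw (fun ω p => Y p ω) P :=
    hZ.indep.hasGaussianLaw fun p => (hlaw p).hasGaussianLaw
  have hae : (fun ω (p : Fin n × Fin n) => Y (sortPair p) ω) =ᵐ[P]
      fun ω (p : Fin n × Fin n) => Z ω p.1 p.2 := by
    filter_upwards [hZ.symm] with ω hω
    ext ⟨i, j⟩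
    rcases le_total i j with h | h
    · simp [Y, sortPair, h]
    · simp only [Y, sortPair, h, min_eq_right, max_eq_left]
      exact hω.apply i j
  have hG : HasGaussianLaw (fun ω (p : Fin n × Fin n) => Z ω p.1 p.2) P :=
    (hYG.map (ContinuousLinearMap.pi fun p => ContinuousLinearMap.proj (sortPair p))).congr hae
  have hmean : ∀ p, ∫ ω, Y p ω ∂P = 0 := fun p => by
    rw [(hlaw p).integral_eq, integral_id_gaussianReal]
  have hLp : ∀ p, MemLp (Y p) 2 P := fun p => (hYG.eval p).memLp_two
  have hsec : ∀ p q, ∫ ω, Y p ω * Y q ω ∂P =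
      if p = q then v * (1 + if p.1.1 = p.1.2 then 1 else 0) else 0 := by
    intro p q
    have h1 := covariance_eq_sub (hLp p) (hLp q)
    rw [hmean, hmean, mul_zero, sub_zero] at h1
    refine h1.symm.trans ?_
    split_ifs with hpq hd
    · subst hpq
      rw [covariance_self (hLp p).1.aemeasurable, (hlaw p).variance_eq, variance_id_gaussianReal,
        Real.coe_toNNReal _ (by positivity)]
      simp [hd]
    · subst hpq
      rw [covariance_self (hLp p).1.aemeasurable, (hlaw p).variance_eq, variance_id_gaussianReal,
        Real.coe_toNNReal _ (by positivity)]
      simp [hd]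
    · exact (hZ.indep.indepFun hpq).covariance_eq_zero (hLp p) (hLp q)
  refine ⟨hG, hG.isCenteredGaussianWithCov (fun p => ?_) fun p q => ?_⟩
  · rw [← hmean (sortPair p)]
    refine integral_congr_ae ?_
    filter_upwards [hae] with ω hω
    exact (congrFun hω p).symm
  · have : ∫ ω, Z ω p.1 p.2 * Z ω q.1 q.2 ∂P = ∫ ω, Y (sortPair p) ω * Y (sortPair q) ω ∂P := by
      refine integral_congr_ae ?_
      filter_upwards [hae] with ω hω
      rw [← congrFun hω p, ← congrFun hω q]
    rw [this, hsec, goeCov]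
    simp only [sortPair_eq_iff]
    have hdiag : ((sortPair p).1.1 = (sortPair p).1.2) ↔ p = p.swap := by
      obtain ⟨a, b⟩ := p
      rcases le_total a b with h | h <;> simp [sortPair, h, eq_comm]
    simp only [hdiag]
    by_cases h1 : p = q
    · subst h1
      simp [eq_comm]
    · by_cases h2 : p.swap = q
      · subst h2
        simp [h1]
      · simp [h1, h2]

end GOE

theorem l2Norm_sq_sub_avgSq {d : ℕ} (hd : 1 ≤ d) {s : ℤ → ℝ} (hs : Summable fun k => s k ^ 2) :
    l2Norm s ^ 2 - avgSq d s = (∑' k : {k : ℤ // (d : ℤ) < |k|}, s k ^ 2) +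
      1 / (d : ℝ) * ∑ k ∈ Finset.Icc (-(d : ℤ)) d, |(k : ℝ)| * s k ^ 2 := by
  have h1 : ∑' k : {k : ℤ // (d : ℤ) < |k|}, s k ^ 2 =
      ∑' k : {k : ℤ // k ∉ Finset.Icc (-(d : ℤ)) d}, s k ^ 2 := by
    refine (Equiv.subtypeEquivRight fun k => ?_).tsum_eq
      (fun k : {k : ℤ // k ∉ Finset.Icc (-(d : ℤ)) d} => s k ^ 2)
    rw [Finset.mem_Icc, ← abs_le, not_le]
  rw [l2Norm, Real.sq_sqrt (tsum_nonneg fun k => sq_nonneg _), h1,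
    ← hs.sum_add_tsum_subtype_compl (Finset.Icc (-(d : ℤ)) d), avgSq_eq hd, Finset.mul_sum]
  have h2 : ∑ k ∈ Finset.Icc (-(d : ℤ)) d, (1 - |(k : ℝ)| / (d : ℝ)) * s k ^ 2 =
      ∑ k ∈ Finset.Icc (-(d : ℤ)) d, s k ^ 2 -
      ∑ k ∈ Finset.Icc (-(d : ℤ)) d, 1 / (d : ℝ) * (|(k : ℝ)| * s k ^ 2) := by
    rw [← Finset.sum_sub_distrib]
    exact Finset.sum_congr rfl fun k _ => by ring
  rw [h2]
  ring

theorem sum_goeCov_self (n : ℕ) (v : ℝ) : ∑ p, goeCov n v p p = v * (n * (n + 1)) := by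
  simp only [goeCov, ← Finset.mul_sum, Fintype.sum_prod_type, Prod.swap_prod_mk, Prod.mk.injEq]
  congr 1
  have : ∀ i j : Fin n, (if j = i ∧ i = j then (1 : ℝ) else 0) = if i = j then 1 else 0 := by
    intro i j
    by_cases h : i = j <;> simp [h]
  simp [this, Finset.sum_add_distrib]
  ring

/-- Coupling `y` with `c • y` costs `|c - 1| E‖y‖`, and `E‖y‖` is at most the square root of the
trace of the covariance. -/
theorem abs_integral_sub_integral_smul_le {n : ℕ} {ν : Measure (Fin n × Fin n → ℝ)} {v : ℝ}
    (hν : IsCenteredGaussianWithCov ν (goeCov n v)) {g : Matrix (Fin n) (Fin n) ℝ → ℝ}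
    (hg : LipschitzWith 1 g) (c : ℝ) :
    |∫ y, g (Matrix.of fun i j => (c • y) (i, j)) ∂ν - ∫ y, g (Matrix.of fun i j => y (i, j)) ∂ν| ≤
      |c - 1| * √(v * (n * (n + 1))) := by
  have := hν.gaussian
  have iG : ∀ p, Integrable (fun y : Fin n × Fin n → ℝ => y p) ν := fun p =>
    (polyGrowth_eval p).integrable ν
  have i1 := integrable_comp_of_lipschitz hg (continuous_comp_of hg) (ε := 0) (by simp)
    (Y := fun y => c • y) fun p => (iG p).const_mul c
  have i2 := integrable_comp_of_lipschitz hg (continuous_comp_of hg) (ε := 0) (by simp) iG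
  have Psq : PolyGrowth (fun y : Fin n × Fin n → ℝ => ∑ p, y p * y p) :=
    .sum _ fun p _ => (polyGrowth_eval p).mul (polyGrowth_eval p)
  have h0 : ∀ y : Fin n × Fin n → ℝ, 0 ≤ ∑ p, y p * y p := fun y =>
    Finset.sum_nonneg fun p _ => mul_self_nonneg _
  have hs : ∫ y, ∑ p, y p * y p ∂ν = v * (n * (n + 1)) := by
    rw [integral_finsetSum _ fun p _ => ((polyGrowth_eval p).mul (polyGrowth_eval p)).integrable ν]
    simp only [hν.second, sum_goeCov_self]
  have hint : Integrable (fun y : Fin n × Fin n → ℝ => √(∑ p, y p * y p)) ν := by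
    refine Integrable.mono' (g := fun y => 1 + ∑ p, y p * y p)
      ((integrable_const _).add (Psq.integrable _))
      (Real.continuous_sqrt.comp Psq.1).aestronglyMeasurable (.of_forall fun z => ?_)
    rw [Real.norm_of_nonneg (Real.sqrt_nonneg _), Real.sqrt_le_iff]
    constructor <;> nlinarith [h0 z]
  rw [← integral_sub i1 i2, ← Real.norm_eq_abs, ← hs]
  refine (norm_integral_le_of_norm_le (hint.const_mul |c - 1|) (.of_forall fun y => ?_)).trans ?_
  · rw [Real.norm_eq_abs]
    refine (abs_sub_le_of_lipschitz hg (c • y) y).trans (le_of_eq ?_)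
    have : ∑ p, ((c • y) p - y p) ^ 2 = (c - 1) ^ 2 * ∑ p, y p * y p := by
      rw [Finset.mul_sum]
      refine Finset.sum_congr rfl fun p _ => ?_
      simp only [Pi.smul_apply, smul_eq_mul]
      ring
    rw [this, Real.sqrt_mul (sq_nonneg _), Real.sqrt_sq_eq_abs]
  · rw [integral_const_mul]
    exact mul_le_mul_of_nonneg_left (integral_sqrt_le_sqrt_integral ν (Psq.integrable _) h0)
      (abs_nonneg _)

theorem isCenteredGaussianWithCov_map_smul {n : ℕ} {ν : Measure (Fin n × Fin n → ℝ)} {v : ℝ}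
    (hν : IsCenteredGaussianWithCov ν (goeCov n v)) (c : ℝ) :
    IsCenteredGaussianWithCov (ν.map fun y => c • y) (goeCov n (c ^ 2 * v)) := by
  have := hν.gaussian
  have hG : HasGaussianLaw (fun y : Fin n × Fin n → ℝ => c • y) ν :=
    (IsGaussian.hasGaussianLaw_id (μ := ν)).map
      (c • ContinuousLinearMap.id ℝ (Fin n × Fin n → ℝ))
  refine hG.isCenteredGaussianWithCov (fun p => ?_) fun p q => ?_
  · simp [integral_const_mul, hν.mean]
  · have : ∀ y : Fin n × Fin n → ℝ, (c • y) p * (c • y) q = c ^ 2 * (y p * y q) := fun y => by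
      simp only [Pi.smul_apply, smul_eq_mul]
      ring
    simp only [this, integral_const_mul, hν.second, goeCov]
    ring

theorem one_le_l2Norm {s : ℤ → ℝ} (hs0 : s 0 = 1) (hs : Summable fun k => s k ^ 2) :
    1 ≤ l2Norm s := by
  rw [l2Norm, Real.one_le_sqrt]
  simpa [hs0] using hs.le_tsum 0 fun k _ => sq_nonneg (s k)

theorem abs_integral_sub_le_of_goeCov {n d : ℕ} {s : ℤ → ℝ} (hs0 : s 0 = 1)
    (hs : Summable fun k => s k ^ 2) (hd : 1 ≤ d) {μ ν : Measure (Fin n × Fin n → ℝ)}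
    (hμ : IsCenteredGaussianWithCov μ (goeCov n (avgSq d s)))
    (hν : IsCenteredGaussianWithCov ν (goeCov n (l2Norm s ^ 2)))
    {g : Matrix (Fin n) (Fin n) ℝ → ℝ} (hg : LipschitzWith 1 g) :
    |∫ y, g (Matrix.of fun i j => y (i, j)) ∂μ - ∫ y, g (Matrix.of fun i j => y (i, j)) ∂ν| ≤
      √((n : ℝ) * (n + 1)) / l2Norm s * (l2Norm s ^ 2 - avgSq d s) := by
  have hv := one_le_avgSq hd hs0
  have hl := one_le_l2Norm hs0 hs
  have hl0 : 0 < l2Norm s := by linarith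
  have hdiff : 0 ≤ l2Norm s ^ 2 - avgSq d s := by
    rw [l2Norm_sq_sub_avgSq hd hs]
    have : 0 ≤ ∑' k : {k : ℤ // (d : ℤ) < |k|}, s k ^ 2 := tsum_nonneg fun k => sq_nonneg _
    positivity
  set σ := √(avgSq d s) with hσ
  have hσ2 : σ ^ 2 = avgSq d s := Real.sq_sqrt (by linarith)
  have hσ0 : 0 ≤ σ := Real.sqrt_nonneg _
  -- The two covariances are proportional, so the laws differ by a dilation with ratio the quotient
  -- of the standard deviations.
  have hμν : μ = ν.map fun y => (σ / l2Norm s) • y := by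
    refine hμ.ext ?_
    have := isCenteredGaussianWithCov_map_smul hν (σ / l2Norm s)
    rwa [← mul_pow, div_mul_cancel₀ _ hl0.ne', hσ2] at this
  rw [hμν, integral_map (by fun_prop) (continuous_comp_of hg).aestronglyMeasurable]
  refine (abs_integral_sub_integral_smul_le hν hg _).trans ?_
  rw [Real.sqrt_mul (sq_nonneg _), Real.sqrt_sq hl0.le, ← hσ2, div_mul_eq_mul_div, le_div_iff₀ hl0]
  rw [← hσ2] at hdiff
  have hle : σ ≤ l2Norm s := by nlinarith
  have hc : |σ / l2Norm s - 1| * l2Norm s = l2Norm s - σ := by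
    rw [abs_of_nonpos (by rw [sub_nonpos]; exact div_le_one_of_le₀ hle hl0.le)]
    field_simp
    ring
  -- Here `l2Norm s` is bounded by `l2Norm s + σ`, turning a difference of standard deviations into
  -- one of variances.
  have h1 : (l2Norm s - σ) * l2Norm s ≤ l2Norm s ^ 2 - σ ^ 2 := by nlinarith
  calc |σ / l2Norm s - 1| * (l2Norm s * √((n : ℝ) * (n + 1))) * l2Norm s
      = |σ / l2Norm s - 1| * l2Norm s * l2Norm s * √((n : ℝ) * (n + 1)) := by ring
    _ = √((n : ℝ) * (n + 1)) * ((l2Norm s - σ) * l2Norm s) := by rw [hc, mul_comm]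
    _ ≤ _ := mul_le_mul_of_nonneg_left h1 (Real.sqrt_nonneg _)

end WishartGaussian

/-! ### The main theorem -/

open WishartGaussian

theorem theorem1 {Ω : Type*} [MeasurableSpace Ω] (P : Measure Ω) [IsProbabilityMeasure P]
    (s : ℤ → ℝ) (hs0 : s 0 = 1)
    (X : ℕ → ℕ → Ω → ℝ) (hX : WishartGaussian.IsRowIndepGaussianArray s X P)
    (n d : ℕ) (hn : 1 ≤ n) (hd : 1 ≤ d)
    {Ω' : Type*} [MeasurableSpace Ω'] (P' : Measure Ω') [IsProbabilityMeasure P']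
    (G : Ω' → Matrix (Fin n) (Fin n) ℝ)
    (hG : WishartGaussian.IsGaussianCounterpart (WishartGaussian.wishart X n d) P G P') :
    (WishartGaussian.dWass (WishartGaussian.wishart X n d) P G P' ≤
        ENNReal.ofReal (√(192 * (n : ℝ) ^ 3 /
            (∑ k ∈ Finset.Icc (-(d : ℤ)) d, (1 - |(k : ℝ)| / (d : ℝ)) * s k ^ 2) *
          ((1 / (d : ℝ)) *
            (∑ k ∈ Finset.Icc (-(d : ℤ)) d, |s k| ^ ((4 : ℝ) / 3)) ^ 3))) ∧
      √(192 * (n : ℝ) ^ 3 /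
            (∑ k ∈ Finset.Icc (-(d : ℤ)) d, (1 - |(k : ℝ)| / (d : ℝ)) * s k ^ 2) *
          ((1 / (d : ℝ)) *
            (∑ k ∈ Finset.Icc (-(d : ℤ)) d, |s k| ^ ((4 : ℝ) / 3)) ^ 3)) ≤
        √(192 * (n : ℝ) ^ 3 / (d : ℝ) *
          (∑ k ∈ Finset.Icc (-(d : ℤ)) d, |s k| ^ ((4 : ℝ) / 3)) ^ 3)) ∧
    (Summable (fun k : ℤ => s k ^ 2) →
      ∀ {Ω'' : Type*} [MeasurableSpace Ω''] (P'' : Measure Ω'') [IsProbabilityMeasure P'']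
        (Z : Ω'' → Matrix (Fin n) (Fin n) ℝ),
        WishartGaussian.IsGOE (WishartGaussian.l2Norm s ^ 2) Z P'' →
        WishartGaussian.dWass G P' Z P'' ≤
          ENNReal.ofReal (2 * √((n : ℝ) * ((n : ℝ) + 1)) / WishartGaussian.l2Norm s *
            ((∑' k : {k : ℤ // (d : ℤ) < |k|}, s k ^ 2) +
              (1 / (d : ℝ)) * ∑ k ∈ Finset.Icc (-(d : ℤ)) d, |(k : ℝ)| * s k ^ 2))) := by
  have hGlaw := hG.isCenteredGaussianWithCov hd hX
  have hGint : ∀ g : Matrix (Fin n) (Fin n) ℝ → ℝ, LipschitzWith 1 g → ∫ ω, g (G ω) ∂P' =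
      ∫ y, g (Matrix.of fun i j => y (i, j)) ∂(P'.map fun ω (p : Fin n × Fin n) => G ω p.1 p.2) :=
    fun g hg => (integral_map hG.gaussian.aemeasurable
      (continuous_comp_of hg).aestronglyMeasurable).symm
  refine ⟨⟨iSup₂_le fun g hg => ENNReal.ofReal_le_ofReal ((le_abs_self _).trans ?_), ?_⟩,
    fun hs Ω'' _ P'' _ Z hZ =>
      iSup₂_le fun g hg => ENNReal.ofReal_le_ofReal ((le_abs_self _).trans ?_)⟩
  · have hWint : ∫ ω, g (wishart X n d ω) ∂P = ∫ x, g (Matrix.of fun i j => wishartMap n d x (i, j))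
        ∂(P.map fun ω (p : Fin n × Fin d) => X p.1 p.2 ω) := by
      simp only [wishart_eq_wishartMap hd]
      exact (integral_map (hX.hasGaussianLaw n d).aemeasurable
        ((continuous_comp_of hg).comp (continuous_wishartMap n d)).aestronglyMeasurable).symm
    rw [hWint, hGint g hg, ← avgSq_eq hd]
    exact abs_integral_sub_le_of_lipschitz hs0 hX.neg_eq hn hd (hX.isCenteredGaussianWithCov n d)
      hGlaw hg
  · rw [← avgSq_eq hd]
    refine Real.sqrt_le_sqrt ?_
    rw [← mul_assoc, mul_one_div]
    gcongr
    exact div_le_self (by positivity) (one_le_avgSq hd hs0)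
  · obtain ⟨hZG, hZlaw⟩ := hZ.isCenteredGaussianWithCov (sq_nonneg _)
    have hZint : ∫ ω, g (Z ω) ∂P'' = ∫ y, g (Matrix.of fun i j => y (i, j))
        ∂(P''.map fun ω (p : Fin n × Fin n) => Z ω p.1 p.2) :=
      (integral_map hZG.aemeasurable (continuous_comp_of hg).aestronglyMeasurable).symm
    have h := abs_integral_sub_le_of_goeCov hs0 hs hd hGlaw hZlaw hg
    rw [← hGint g hg, ← hZint] at h
    -- The scaling argument proves the bound without the factor 2; the second copy is nonnegative
    -- and is dropped.
    rw [← l2Norm_sq_sub_avgSq hd hs, mul_div_assoc, mul_assoc, two_mul]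
    exact h.trans (le_add_of_nonneg_left ((abs_nonneg _).trans h))
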